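/- Let $\Omega\subset\mathbb R^2$ be a bounded polygonal domain (without cracks) with vertices $Q_1,\dots,Q_N$, let $k,m\ge 1$ be integers, and let $\mathbf a=(a_1,\dots,a_N)$ and $\theta$ be real with $0<a_j\le\theta\le\min\{k,m\}$ for all $j$. Put $\kappa_{Q_j}=2^{-\theta/a_j}\in(0,\tfrac12]$. For $G\subset\Omega$ open and a vector $\mathbf b=(b_1,\dots,b_N)$, let $\mathcal K^{l}_{\mathbf b}(G)$ be the space of functions $v$ with $\rho^{|\nu|-\mathbf b}\partial^\nu v\in L^2(G)$ for all $|\nu|\le l$ (weak derivatives), where $\rho^{s-\mathbf b}(x)=\prod_j|x-Q_j|^{s-b_j}$; for a single vertex $Q_i$ and a scalar $b$ let $$\|v\|_{\mathcal K^{l}_{b}(G)}=\Big(\sum_{|\nu|\le l}\int_G\big||x-Q_i|^{|\nu|-b}\,\partial^\nu v\big|^2dx\Big)^{1/2}.$$ Let $\mathcal T_0$ be a conforming triangulation of $\Omega$ each of whose closed triangles contains at most one of the points $Q_j$. Given $\mathcal T_n$, the mesh $\mathcal T_{n+1}$ is obtained by choosing a node $D$ on each edge $AB$, with $|AD|=\kappa_{Q_j}|AB|$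 if $A=Q_j$ for some $j$ and $D$ the midpoint if neither endpoint is a vertex of $\Omega$, and by decomposing each triangle into four by joining its three new nodes. Let $V_n^k$ be the space of continuous functions on $\overline\Omega$ that are polynomials of degree at most $k$ on each triangle of $\mathcal T_n$. For $v\in\mathcal K^{m+1}_{\mathbf a+1}(\Omega)$ let $v_I\in V_n^k$ be its nodal (Lagrange) interpolation, that is, the element of $V_n^k$ that agrees with the representative of $v$ continuous on $\overline\Omega$ at all Lagrange nodes of degree $k$. Let $T_{(0)}\in\mathcal T_0$ have $Q_i$ as a vertex, and let the innermost mesh layer $L_n=T_{(n)}$ be the triangle of $\mathcal T_n$ contained in $T_{(0)}$ and attached to $Q_i$. Then there is a constant $C>0$, independent of $n$ and of $v$, such that for all sufficiently large $n$ (how large not depending on $v$), with $h=2^{-n}$, $$|v-v_I|_{H^1(L_n)}\le C\,h^{\theta}\,\|v\|_{\mathcal K^{m+1}_{a_i+1}(L_n)}\qquad\text{for all } v\in\mathcal K^{m+1}_{\mathbf a+1}(\Omega).$$ -/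

import Mathlib

open MeasureTheory Set
open scoped ENNReal ContDiff

/-- The Euclidean plane. -/
abbrev Plane := EuclideanSpace ℝ (Fin 2)

/-! ### Polygonal domains -/

/-- `x` is a corner of `Ω`: a boundary point near which `Ω` is not an open half-plane. -/
def IsBoundaryCorner (Ω : Set Plane) (x : Plane) : Prop :=
  x ∈ frontier Ω ∧
    ¬ ∃ r : ℝ, 0 < r ∧ ∃ u : Plane, u ≠ 0 ∧
      Ω ∩ Metric.ball x r = {y | 0 < inner ℝ u (y - x)} ∩ Metric.ball x r

/-- `Ω` is a bounded polygonal domain and `Q 0, …, Q (N-1)` are its vertices, listed without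
repetition. The condition `regular` says that there are no cracks and no punctures. -/
structure IsPolygonalDomain {N : ℕ} (Ω : Set Plane) (Q : Fin N → Plane) : Prop where
  isOpen : IsOpen Ω
  isConnected : IsConnected Ω
  isBounded : Bornology.IsBounded Ω
  regular : interior (closure Ω) = Ω
  boundary : ∃ S : Set (Plane × Plane), S.Finite ∧ frontier Ω = ⋃ s ∈ S, segment ℝ s.1 s.2
  injective : Function.Injective Q
  range_eq : range Q = {x | IsBoundaryCorner Ω x}

/-! ### Weak derivatives and weighted Sobolev norms -/

/-- The partial derivative `∂φ/∂x_j`. -/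
noncomputable def partialDeriv (j : Fin 2) (φ : Plane → ℝ) : Plane → ℝ :=
  fun x => fderiv ℝ φ x (EuclideanSpace.single j 1)

/-- `∂^ν φ = ∂_x^{ν₁} ∂_y^{ν₂} φ` for smooth `φ`. -/
noncomputable def multiDeriv (ν : ℕ × ℕ) (φ : Plane → ℝ) : Plane → ℝ :=
  (partialDeriv 0)^[ν.1] ((partialDeriv 1)^[ν.2] φ)

/-- `g` is a weak derivative `∂^ν v` on the open set `G`. -/
def HasWeakDeriv (G : Set Plane) (ν : ℕ × ℕ) (v g : Plane → ℝ) : Prop :=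
  LocallyIntegrableOn v G ∧ LocallyIntegrableOn g G ∧
    ∀ φ : Plane → ℝ, ContDiff ℝ ∞ φ → HasCompactSupport φ → tsupport φ ⊆ G →
      ∫ x in G, v x * multiDeriv ν φ x = (-1) ^ (ν.1 + ν.2) * ∫ x in G, g x * φ x

/-- The weight `ρ^{l - b} = ∏ⱼ |x - Pⱼ|^{l - bⱼ}`. -/
noncomputable def cornerWeight {ι : Type} [Fintype ι] (P : ι → Plane) (b : ι → ℝ) (l : ℕ) :
    Plane → ℝ :=
  fun x => ∏ j, dist x (P j) ^ ((l : ℝ) - b j)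

/-- `v ∈ 𝒦^m_b(G)`: `ρ^{|ν| - b} ∂^ν v ∈ L²(G)` for all `|ν| ≤ m`, with weak derivatives. -/
def MemKondratiev {ι : Type} [Fintype ι] (P : ι → Plane) (b : ι → ℝ) (m : ℕ)
    (G : Set Plane) (v : Plane → ℝ) : Prop :=
  ∀ ν : ℕ × ℕ, ν.1 + ν.2 ≤ m → ∃ g : Plane → ℝ, HasWeakDeriv G ν v g ∧
    MemLp (fun x => cornerWeight P b (ν.1 + ν.2) x * g x) 2 (volume.restrict G)

/-- `∑_{|ν| = l} ‖w ∂^ν v‖²_{L²(G)}`. A weak derivative is unique almost everywhere, so the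
infimum over all weak derivatives is the value for any of them; it is `∞` if there is none. -/
noncomputable def weightedSqSum (G : Set Plane) (w : Plane → ℝ) (l : ℕ) (v : Plane → ℝ) : ℝ≥0∞ :=
  ∑ ν ∈ Finset.HasAntidiagonal.antidiagonal l,
    ⨅ (g : Plane → ℝ) (_ : HasWeakDeriv G ν v g), ∫⁻ x in G, ‖w x * g x‖ₑ ^ 2

/-- The norm of `𝒦^m_b(G)`: the square root of
`∑_{|ν| ≤ m} ∫_G |ρ^{|ν| - b} ∂^ν v|²`, with value `∞` off the space. -/
noncomputable def kondratievNorm {ι : Type} [Fintype ι] (P : ι → Plane) (b : ι → ℝ) (m : ℕ)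
    (G : Set Plane) (v : Plane → ℝ) : ℝ≥0∞ :=
  (∑ l ∈ Finset.range (m + 1), weightedSqSum G (cornerWeight P b l) l v) ^ (1 / 2 : ℝ)

/-- The seminorm `|v|_{H¹(G)}`, with value `∞` if `∇v` is not a weak gradient in `L²(G)`. -/
noncomputable def h1Seminorm (G : Set Plane) (v : Plane → ℝ) : ℝ≥0∞ :=
  (weightedSqSum G (fun _ => 1) 1 v) ^ (1 / 2 : ℝ)

/-! ### Triangulations and graded refinement -/

/-- A triangle, given by its three vertices. -/
abbrev PlaneTriangle := Fin 3 → Plane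

/-- The closed triangle as a subset of the plane. -/
def PlaneTriangle.closed (T : PlaneTriangle) : Set Plane := convexHull ℝ (range T)

/-- The open triangle. -/
def PlaneTriangle.opened (T : PlaneTriangle) : Set Plane := interior T.closed

/-- `𝒯` is a conforming triangulation of `Ω`. -/
structure IsTriangulation (Ω : Set Plane) (𝒯 : Set PlaneTriangle) : Prop where
  finite : 𝒯.Finite
  nondegenerate : ∀ T ∈ 𝒯, AffineIndependent ℝ T
  cover : ⋃ T ∈ 𝒯, PlaneTriangle.closed T = closure Ω
  conforming : ∀ T ∈ 𝒯, ∀ T' ∈ 𝒯,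
    PlaneTriangle.closed T ∩ PlaneTriangle.closed T' = convexHull ℝ (range T ∩ range T')

open Classical in
/-- The new node on the edge `AB`: if `A = Q i` it is the point `D` of `AB` with
`|AD| = κ i |AB|`, likewise if `B = Q i`; if neither endpoint is a vertex of the domain it is the
midpoint. (In the meshes used here `A` and `B` are never two different vertices of the domain.) -/
noncomputable def gradedNode {N : ℕ} (Q : Fin N → Plane) (κ : Fin N → ℝ) (A B : Plane) : Plane :=
  if A ∈ range Q then AffineMap.lineMap A B (Function.extend Q κ (fun _ => 1 / 2) A)
  else if B ∈ range Q then AffineMap.lineMap B A (Function.extend Q κ (fun _ => 1 / 2) B)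
  else midpoint ℝ A B

theorem gradedNode_self {N : ℕ} (Q : Fin N → Plane) (κ : Fin N → ℝ) (A : Plane) :
    gradedNode Q κ A A = A := by
  unfold gradedNode; split_ifs <;> simp

/-- The small triangle at the vertex `T i`: its vertices are `T i` (the entry `j = i`, by
`gradedNode_self`) and the new nodes on the two edges through `T i`. -/
noncomputable def cornerChild {N : ℕ} (Q : Fin N → Plane) (κ : Fin N → ℝ) (T : PlaneTriangle)
    (i : Fin 3) : PlaneTriangle :=
  fun j => gradedNode Q κ (T i) (T j)

/-- The small triangle whose vertices are the three new nodes. -/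
noncomputable def centralChild {N : ℕ} (Q : Fin N → Plane) (κ : Fin N → ℝ) (T : PlaneTriangle) :
    PlaneTriangle :=
  fun j => gradedNode Q κ (T (j + 1)) (T (j + 2))

/-- One graded refinement: every triangle is decomposed into four. -/
def gradedRefine {N : ℕ} (Q : Fin N → Plane) (κ : Fin N → ℝ) (𝒯 : Set PlaneTriangle) :
    Set PlaneTriangle :=
  ⋃ T ∈ 𝒯, insert (centralChild Q κ T) (range (cornerChild Q κ T))

/-- The family of graded meshes `𝒯_n` with initial mesh `𝒯₀`. -/
def gradedMesh {N : ℕ} (Q : Fin N → Plane) (κ : Fin N → ℝ) (𝒯₀ : Set PlaneTriangle) :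
    ℕ → Set PlaneTriangle
  | 0 => 𝒯₀
  | n + 1 => gradedRefine Q κ (gradedMesh Q κ 𝒯₀ n)

/-- `T` is the triangle `T_(t)` of `𝒯_t` that lies in `T₀` and is attached to `q`; the innermost
layer of `𝒯_n` on `T₀` is `T_(n)`. -/
def IsAttachedTriangle {N : ℕ} (Q : Fin N → Plane) (κ : Fin N → ℝ) (𝒯₀ : Set PlaneTriangle)
    (T₀ : PlaneTriangle) (q : Plane) (t : ℕ) (T : PlaneTriangle) : Prop :=
  T ∈ gradedMesh Q κ 𝒯₀ t ∧ T.closed ⊆ T₀.closed ∧ q ∈ range T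

/-! ### Finite elements -/

/-- The Lagrange space of degree `k` on the mesh `𝒯` of `Ω`: continuous functions on the closure
of `Ω` that are polynomials of total degree at most `k` on each triangle. -/
def lagrangeSpace (Ω : Set Plane) (𝒯 : Set PlaneTriangle) (k : ℕ) : Set (Plane → ℝ) :=
  {f | ContinuousOn f (closure Ω) ∧ ∀ T ∈ 𝒯, ∃ p : MvPolynomial (Fin 2) ℝ,
    p.totalDegree ≤ k ∧ ∀ x ∈ PlaneTriangle.closed T, f x = MvPolynomial.eval (fun j => x j) p}

/-- The nodes of the degree `k` Lagrange element on `T`: the points with barycentric coordinates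
in `{0, 1/k, …, 1}`. -/
def lagrangeNodes (k : ℕ) (T : PlaneTriangle) : Set Plane :=
  {x | ∃ α : Fin 3 → ℕ, ∑ j, α j = k ∧ x = ∑ j, ((α j : ℝ) / k) • T j}

/-- `vI` is the nodal interpolation of `v` in the Lagrange space: it agrees at all nodes with the
representative of `v` that is continuous on the closure of `Ω` (unique on the closure, as `Ω` is
open). -/
def IsNodalInterpolant (Ω : Set Plane) (𝒯 : Set PlaneTriangle) (k : ℕ) (v vI : Plane → ℝ) : Prop :=
  vI ∈ lagrangeSpace Ω 𝒯 k ∧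
    ∃ u : Plane → ℝ, ContinuousOn u (closure Ω) ∧ u =ᵐ[volume.restrict Ω] v ∧
      ∀ T ∈ 𝒯, ∀ x ∈ lagrangeNodes k T, vI x = u x

/-! ### Weak derivatives -/

/-! Near $Q_i$ each refinement keeps only a copy of the ancestor triangle shrunk towards $Q_i$ by
the factor $\kappa_{Q_i}$, so $L_n$ is a homothetic copy, with ratio $r=\kappa_{Q_i}^n$, of a
triangle of $\mathcal T_0$ (`gradedMesh_eq_homothety`). Since $r^{a_i}=2^{-n\theta}=h^\theta$, it
suffices to bound the error on a triangle scaled by $r$ by $C r^{a}$ times the weighted norm, with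
$C$ independent of $r$ (`AffineBasis.exists_interpolation_error_le`).

No cancellation between $v$ and $v_I$ is used: each is small by itself. For $v$, the weight gives
$|\nabla v|\le (Dr)^{a}\,\rho^{-a}|\nabla v|$. For $v_I$, scaling of polynomials bounds the gradient
by $C r^{-1}$ times the largest nodal value (`AffineBasis.exists_partialDeriv_le`); the area is of
order $r^2$, so it remains to bound the nodal values by $C r^{a}$ times the norm.

At the node $Q_i$ the value is zero, because $\rho^{-a-1}v$ is not square integrable near $Q_i$ if
the continuous representative is nonzero there (`eq_zero_of_weighted`). At any other node $z$ there
is a parallelogram with corner $z$, of size comparable to $r$, inside the triangle and at distance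
comparable to $r$ from $Q_i$. There the weights are comparable to powers of $r$, and the embedding
of $W^{2,1}$ into continuous functions, with explicit scaling, gives the bound
(`exists_pointwise_bound`, `AffineBasis.exists_node_bound`).

This embedding is obtained from the definition of weak derivatives alone: the function is tested
against an approximate identity at the corner, which is a fixed bump plus derivatives of uniformly
bounded functions, and these derivatives are moved onto $v$. Only derivatives of order at most two
enter, hence $m\ge 1$ suffices. -/

theorem ContDiff.partialDeriv {φ : Plane → ℝ} (hφ : ContDiff ℝ ∞ φ) (j : Fin 2) :
    ContDiff ℝ ∞ (partialDeriv j φ) :=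
  (hφ.fderiv_right (m := ∞) (by simp)).clm_apply contDiff_const

theorem tsupport_partialDeriv_subset (j : Fin 2) (φ : Plane → ℝ) :
    tsupport (partialDeriv j φ) ⊆ tsupport φ :=
  tsupport_fderiv_apply_subset ℝ _

theorem ContDiff.multiDeriv {φ : Plane → ℝ} (hφ : ContDiff ℝ ∞ φ) (ν : ℕ × ℕ) :
    ContDiff ℝ ∞ (multiDeriv ν φ) := by
  have key : ∀ (j : Fin 2) (n : ℕ) (ψ : Plane → ℝ), ContDiff ℝ ∞ ψ →
      ContDiff ℝ ∞ ((_root_.partialDeriv j)^[n] ψ) := by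
    intro j n
    induction n with
    | zero => exact fun ψ h => h
    | succ n ih => exact fun ψ h => ih _ (h.partialDeriv j)
  exact key 0 _ _ (key 1 _ _ hφ)

theorem tsupport_multiDeriv_subset (ν : ℕ × ℕ) (φ : Plane → ℝ) :
    tsupport (multiDeriv ν φ) ⊆ tsupport φ := by
  have key : ∀ (j : Fin 2) (n : ℕ) (ψ : Plane → ℝ),
      tsupport ((partialDeriv j)^[n] ψ) ⊆ tsupport ψ := by
    intro j n
    induction n with
    | zero => exact fun ψ => subset_rfl
    | succ n ih => exact fun ψ => (ih _).trans (tsupport_partialDeriv_subset j ψ)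
  exact (key 0 _ _).trans (key 1 _ _)

theorem multiDeriv_zero (φ : Plane → ℝ) : multiDeriv (0, 0) φ = φ := rfl

theorem multiDeriv_one_zero (φ : Plane → ℝ) : multiDeriv (1, 0) φ = partialDeriv 0 φ := rfl

theorem multiDeriv_zero_one (φ : Plane → ℝ) : multiDeriv (0, 1) φ = partialDeriv 1 φ := rfl

/-- A locally integrable function times a compactly supported continuous one is integrable. -/
theorem MeasureTheory.LocallyIntegrableOn.integrableOn_mul_of_tsupport_subset
    {G : Set Plane} {v φ : Plane → ℝ}
    (hv : LocallyIntegrableOn v G) (hφ : Continuous φ) (hc : HasCompactSupport φ)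
    (hs : tsupport φ ⊆ G) : Integrable (fun x => v x * φ x) := by
  have h1 : IntegrableOn v (tsupport φ) := hv.integrableOn_compact_subset hs hc
  have h2 : IntegrableOn (fun x => v x * φ x) (tsupport φ) :=
    h1.mul_continuousOn hφ.continuousOn hc
  refine (integrableOn_iff_integrable_of_support_subset ?_).1 h2
  intro x hx
  exact subset_tsupport _ (right_ne_zero_of_mul hx)

theorem setIntegral_mul_eq_integral {G : Set Plane} {v φ : Plane → ℝ} (hs : tsupport φ ⊆ G) :
    ∫ x in G, v x * φ x = ∫ x, v x * φ x := by
  refine setIntegral_eq_integral_of_forall_compl_eq_zero fun x hx => ?_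
  rw [image_eq_zero_of_notMem_tsupport (fun h => hx (hs h)), mul_zero]

/-- The fundamental lemma of the calculus of variations: the difference of the two candidates
integrates to zero against every test function. -/
theorem HasWeakDeriv.ae_eq {G : Set Plane} (hG : IsOpen G) {ν : ℕ × ℕ} {v g g' : Plane → ℝ}
    (h : HasWeakDeriv G ν v g) (h' : HasWeakDeriv G ν v g') : g =ᵐ[volume.restrict G] g' := by
  have key : ∀ᵐ x, x ∈ G → (g - g') x = 0 := by
    refine hG.ae_eq_zero_of_integral_contDiff_smul_eq_zero (h.2.1.sub h'.2.1) ?_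
    intro φ hφ hc hs
    have e := (h.2.2 φ hφ hc hs).symm.trans (h'.2.2 φ hφ hc hs)
    have e' := mul_left_cancel₀ (pow_ne_zero _ (by norm_num)) e
    rw [setIntegral_mul_eq_integral hs, setIntegral_mul_eq_integral hs] at e'
    have i1 := h.2.1.integrableOn_mul_of_tsupport_subset hφ.continuous hc hs
    have i2 := h'.2.1.integrableOn_mul_of_tsupport_subset hφ.continuous hc hs
    calc ∫ x, φ x • (g - g') x = ∫ x, (g x * φ x - g' x * φ x) := by
          congr 1; ext x; simp only [Pi.sub_apply, smul_eq_mul]; ring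
      _ = 0 := by rw [integral_sub i1 i2, e', sub_self]
  rw [Filter.EventuallyEq, ae_restrict_iff' hG.measurableSet]
  filter_upwards [key] with x hx hxG
  exact sub_eq_zero.1 (hx hxG)

/-- The infimum in `weightedSqSum` is attained at any weak derivative. -/
theorem HasWeakDeriv.iInf_lintegral_eq {G : Set Plane} (hG : IsOpen G) {ν : ℕ × ℕ}
    {v g : Plane → ℝ} (h : HasWeakDeriv G ν v g) (w : Plane → ℝ) :
    ⨅ (g : Plane → ℝ) (_ : HasWeakDeriv G ν v g), ∫⁻ x in G, ‖w x * g x‖ₑ ^ 2 =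
      ∫⁻ x in G, ‖w x * g x‖ₑ ^ 2 := by
  refine le_antisymm (iInf₂_le g h) (le_iInf₂ fun g' h' => le_of_eq ?_)
  refine lintegral_congr_ae ?_
  filter_upwards [h.ae_eq hG h'] with x hx
  rw [hx]

theorem HasWeakDeriv.sub {G : Set Plane} {ν : ℕ × ℕ} {v v' g g' : Plane → ℝ}
    (h : HasWeakDeriv G ν v g) (h' : HasWeakDeriv G ν v' g') :
    HasWeakDeriv G ν (fun x => v x - v' x) (fun x => g x - g' x) := by
  refine ⟨h.1.sub h'.1, h.2.1.sub h'.2.1, fun φ hφ hc hs => ?_⟩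
  have hD := hφ.multiDeriv ν
  have hDc : HasCompactSupport (multiDeriv ν φ) :=
    hc.of_isClosed_subset (isClosed_tsupport _) (tsupport_multiDeriv_subset ν φ)
  have hDs := (tsupport_multiDeriv_subset ν φ).trans hs
  simp only [sub_mul]
  rw [integral_sub, integral_sub, h.2.2 φ hφ hc hs, h'.2.2 φ hφ hc hs, mul_sub]
  · exact (h.2.1.integrableOn_mul_of_tsupport_subset hφ.continuous hc hs).integrableOn
  · exact (h'.2.1.integrableOn_mul_of_tsupport_subset hφ.continuous hc hs).integrableOn
  · exact (h.1.integrableOn_mul_of_tsupport_subset hD.continuous hDc hDs).integrableOn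
  · exact (h'.1.integrableOn_mul_of_tsupport_subset hD.continuous hDc hDs).integrableOn

/-- Weak derivatives only depend on the function on the open set. -/
theorem HasWeakDeriv.congr {G : Set Plane} (hG : MeasurableSet G) {ν : ℕ × ℕ}
    {v v' g : Plane → ℝ} (h : HasWeakDeriv G ν v g) (hv : EqOn v v' G) :
    HasWeakDeriv G ν v' g := by
  refine ⟨fun x hx => ?_, h.2.1, fun φ hφ hc hs => ?_⟩
  · obtain ⟨s, hs, hi⟩ := h.1 x hx
    refine ⟨s ∩ G, Filter.inter_mem hs self_mem_nhdsWithin, ?_⟩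
    refine ⟨?_, ?_⟩
    · exact (hi.mono_set inter_subset_left).aestronglyMeasurable.congr
        (by
          refine (ae_restrict_of_ae_restrict_of_subset inter_subset_right ?_)
          exact (ae_restrict_iff' hG).2 (Filter.Eventually.of_forall fun x hx => hv hx))
    · exact (hi.mono_set inter_subset_left).2.congr
        (by
          refine (ae_restrict_of_ae_restrict_of_subset inter_subset_right ?_)
          exact (ae_restrict_iff' hG).2 (Filter.Eventually.of_forall fun x hx => hv hx))
  · rw [← h.2.2 φ hφ hc hs]
    exact setIntegral_congr_fun hG fun x hx => by simp only [hv hx]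

theorem ContDiff.integral_mul_partialDeriv {f φ : Plane → ℝ} (hf : ContDiff ℝ ∞ f)
    (hφ : ContDiff ℝ ∞ φ) (hc : HasCompactSupport φ) (j : Fin 2) :
    ∫ x, f x * _root_.partialDeriv j φ x = -∫ x, _root_.partialDeriv j f x * φ x := by
  have hDc : HasCompactSupport (_root_.partialDeriv j φ) :=
    hc.of_isClosed_subset (isClosed_tsupport _) (tsupport_partialDeriv_subset j φ)
  refine integral_mul_fderiv_eq_neg_fderiv_mul_of_integrable ?_ ?_ ?_ ?_ ?_
  · exact ((hf.partialDeriv j).continuous.mul hφ.continuous).integrable_of_hasCompactSupport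
      hc.mul_left
  · exact (hf.continuous.mul (hφ.partialDeriv j).continuous).integrable_of_hasCompactSupport
      hDc.mul_left
  · exact (hf.continuous.mul hφ.continuous).integrable_of_hasCompactSupport hc.mul_left
  · exact fun x _ => hf.differentiable (by simp) x
  · exact fun x _ => hφ.differentiable (by simp) x

/-- The classical first derivatives of a smooth function are weak derivatives. -/
theorem ContDiff.hasWeakDeriv {G : Set Plane} {f : Plane → ℝ} (hf : ContDiff ℝ ∞ f)
    {ν : ℕ × ℕ} (hν : ν ∈ Finset.HasAntidiagonal.antidiagonal 1) :
    HasWeakDeriv G ν f (_root_.multiDeriv ν f) := by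
  refine ⟨hf.continuous.locallyIntegrable.locallyIntegrableOn _,
    (hf.multiDeriv ν).continuous.locallyIntegrable.locallyIntegrableOn _, fun φ hφ hc hs => ?_⟩
  rw [setIntegral_mul_eq_integral hs,
    setIntegral_mul_eq_integral ((tsupport_multiDeriv_subset ν φ).trans hs)]
  rw [Finset.HasAntidiagonal.mem_antidiagonal.1 hν]
  have : ν = (1, 0) ∨ ν = (0, 1) := by
    have := Finset.HasAntidiagonal.mem_antidiagonal.1 hν
    rcases ν with ⟨_ | n, p⟩
    · right; simp at this; simp [this]
    · left; simp at this; ext <;> simp <;> omega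
  rcases this with rfl | rfl
  · simpa [multiDeriv_one_zero, multiDeriv_zero_one] using hf.integral_mul_partialDeriv hφ hc 0
  · simpa [multiDeriv_one_zero, multiDeriv_zero_one] using hf.integral_mul_partialDeriv hφ hc 1

/-! ### One-dimensional cutoff functions -/

/-- Smooth functions with compact support in the open unit interval. -/
structure IsUnitBump (A : ℝ → ℝ) : Prop where
  contDiff : ContDiff ℝ ∞ A
  hasCompactSupport : HasCompactSupport A
  tsupport_subset : tsupport A ⊆ Ioo 0 1

theorem isUnitBump_deriv {A : ℝ → ℝ} (h : IsUnitBump A) : IsUnitBump (deriv A) :=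
  ⟨((contDiff_infty_iff_deriv (𝕜 := ℝ)).1 h.contDiff).2, h.hasCompactSupport.deriv,
    (closure_minimal (support_deriv_subset (𝕜 := ℝ)) (isClosed_tsupport _)).trans h.tsupport_subset⟩

theorem isUnitBump_of_eqOn_zero {A : ℝ → ℝ} {c d : ℝ} (hA : ContDiff ℝ ∞ A) (hc : 0 < c)
    (hd : d < 1) (h : ∀ s, s ∉ Icc c d → A s = 0) : IsUnitBump A := by
  have hs : tsupport A ⊆ Icc c d :=
    closure_minimal (fun s hs => by_contra fun h' => hs (h s h')) isClosed_Icc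
  exact ⟨hA, isCompact_Icc.of_isClosed_subset (isClosed_tsupport _) hs,
    hs.trans fun s hs => ⟨hc.trans_le hs.1, hs.2.trans_lt hd⟩⟩

/-- A smooth monotone step from `0` to `1` on the interval `[δ, 2δ]`. -/
noncomputable def smoothStep (δ s : ℝ) : ℝ := Real.smoothTransition (s / δ - 1)

theorem contDiff_smoothStep (δ : ℝ) : ContDiff ℝ ∞ (smoothStep δ) :=
  Real.smoothTransition.contDiff.comp ((contDiff_id.div_const δ).sub contDiff_const)

theorem smoothStep_eq_zero {δ s : ℝ} (hδ : 0 < δ) (hs : s ≤ δ) : smoothStep δ s = 0 :=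
  Real.smoothTransition.zero_of_nonpos (by rw [sub_nonpos, div_le_one hδ]; exact hs)

theorem smoothStep_eq_one {δ s : ℝ} (hδ : 0 < δ) (hs : 2 * δ ≤ s) : smoothStep δ s = 1 :=
  Real.smoothTransition.one_of_one_le (by
    have : 2 ≤ s / δ := by rwa [le_div_iff₀ hδ]
    linarith)

theorem smoothStep_nonneg (δ s : ℝ) : 0 ≤ smoothStep δ s := Real.smoothTransition.nonneg _

theorem smoothStep_le_one (δ s : ℝ) : smoothStep δ s ≤ 1 := Real.smoothTransition.le_one _

theorem monotone_smoothStep {δ : ℝ} (hδ : 0 < δ) : Monotone (smoothStep δ) := fun _ _ h =>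
  Real.smoothTransition.monotone (sub_le_sub_right (div_le_div_of_nonneg_right h hδ.le) 1)

theorem contDiff_deriv_smoothStep (δ : ℝ) : ContDiff ℝ ∞ (deriv (smoothStep δ)) :=
  ((contDiff_infty_iff_deriv (𝕜 := ℝ)).1 (contDiff_smoothStep δ)).2

theorem deriv_smoothStep_eq_zero {δ s : ℝ} (hδ : 0 < δ) (hs : s ∉ Icc δ (2 * δ)) :
    deriv (smoothStep δ) s = 0 := by
  rcases lt_or_ge s δ with h | h
  · have : smoothStep δ =ᶠ[nhds s] fun _ => 0 := by
      filter_upwards [Iio_mem_nhds h] with t ht using smoothStep_eq_zero hδ (le_of_lt ht)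
    rw [this.deriv_eq, deriv_const]
  · have h' : 2 * δ < s := lt_of_not_ge fun h' => hs ⟨h, h'⟩
    have : smoothStep δ =ᶠ[nhds s] fun _ => 1 := by
      filter_upwards [Ioi_mem_nhds h'] with t ht using smoothStep_eq_one hδ (le_of_lt ht)
    rw [this.deriv_eq, deriv_const]

theorem deriv_smoothStep_nonneg {δ : ℝ} (hδ : 0 < δ) (s : ℝ) : 0 ≤ deriv (smoothStep δ) s :=
  (monotone_smoothStep hδ).deriv_nonneg

theorem isUnitBump_deriv_smoothStep {δ : ℝ} (hδ : 0 < δ) (hδ' : δ ≤ 1 / 3) :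
    IsUnitBump (deriv (smoothStep δ)) :=
  isUnitBump_of_eqOn_zero (contDiff_deriv_smoothStep δ) hδ (by linarith)
    fun _ hs => deriv_smoothStep_eq_zero hδ hs

/-- Both steps are 0 to the left of `δ` and 1 to the right of 2/3. Subtracting the fixed step makes
the step of scale `δ` an admissible test profile while keeping it bounded uniformly in `δ`. -/
theorem isUnitBump_smoothStep_sub {δ : ℝ} (hδ : 0 < δ) (hδ' : δ ≤ 1 / 3) :
    IsUnitBump (fun s => smoothStep δ s - smoothStep (1 / 3) s) := by
  refine isUnitBump_of_eqOn_zero (c := δ) (d := 2 / 3)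
    ((contDiff_smoothStep δ).sub (contDiff_smoothStep _)) hδ (by norm_num) fun s hs => ?_
  rcases lt_or_ge s δ with h | h
  · rw [smoothStep_eq_zero hδ h.le, smoothStep_eq_zero (by norm_num) (by linarith), sub_self]
  · have h' : 2 / 3 < s := lt_of_not_ge fun h' => hs ⟨h, h'⟩
    rw [smoothStep_eq_one hδ (by linarith), smoothStep_eq_one (by norm_num) (by linarith),
      sub_self]

theorem integral_deriv_smoothStep {δ : ℝ} (hδ : 0 < δ) : ∫ s, deriv (smoothStep δ) s = 1 := by
  -- Any endpoint beyond `2 * δ` would do, as the derivative vanishes outside `[δ, 2δ]`.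
  have h1 : ∫ s in (0 : ℝ)..3 * δ, deriv (smoothStep δ) s = 1 := by
    rw [intervalIntegral.integral_deriv_eq_sub
      (fun s _ => (contDiff_smoothStep δ).differentiable (by simp) s)
      ((contDiff_deriv_smoothStep δ).continuous.intervalIntegrable _ _),
      smoothStep_eq_one hδ (by linarith), smoothStep_eq_zero hδ hδ.le, sub_zero]
  rw [← h1, intervalIntegral.integral_of_le (by positivity)]
  refine (setIntegral_eq_integral_of_forall_compl_eq_zero fun s hs => ?_).symm
  refine deriv_smoothStep_eq_zero hδ fun h => hs ⟨hδ.trans_le h.1, h.2.trans (by linarith)⟩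

/-! ### Tensor product test functions on parallelograms -/

/-- The linear functionals `l₁, l₂` are the coordinates with respect to the basis `b₁, b₂`. -/
structure IsDualFrame (b₁ b₂ : Plane) (l₁ l₂ : Plane →L[ℝ] ℝ) : Prop where
  apply₁₁ : l₁ b₁ = 1
  apply₁₂ : l₁ b₂ = 0
  apply₂₁ : l₂ b₁ = 0
  apply₂₂ : l₂ b₂ = 1
  reconstruct : ∀ x, l₁ x • b₁ + l₂ x • b₂ = x

/-- The open parallelogram at `z` spanned by the basis dual to `l₁, l₂`. -/
def openParallelogram (l₁ l₂ : Plane →L[ℝ] ℝ) (z : Plane) : Set Plane :=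
  {x | l₁ (x - z) ∈ Ioo 0 1 ∧ l₂ (x - z) ∈ Ioo 0 1}

theorem isOpen_openParallelogram (l₁ l₂ : Plane →L[ℝ] ℝ) (z : Plane) :
    IsOpen (openParallelogram l₁ l₂ z) :=
  (isOpen_Ioo.preimage (by fun_prop : Continuous fun x => l₁ (x - z))).inter
    (isOpen_Ioo.preimage (by fun_prop : Continuous fun x => l₂ (x - z)))

/-- The product of functions of the two oblique coordinates. -/
def obliqueTensor (l₁ l₂ : Plane →L[ℝ] ℝ) (z : Plane) (A B : ℝ → ℝ) : Plane → ℝ :=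
  fun x => A (l₁ (x - z)) * B (l₂ (x - z))

/-- The oblique coordinates push Lebesgue measure forward to a Haar measure on the product, that is,
to `c` times Lebesgue measure. The same `c` is the area of the parallelogram and the factor in
Fubini, so no determinant has to be computed. -/
theorem IsDualFrame.exists_jacobian {b₁ b₂ : Plane} {l₁ l₂ : Plane →L[ℝ] ℝ}
    (h : IsDualFrame b₁ b₂ l₁ l₂) : ∃ c : ℝ, 0 < c ∧
      (∀ z, volume (openParallelogram l₁ l₂ z) = ENNReal.ofReal c) ∧
      ∀ z A B, ∫ x, obliqueTensor l₁ l₂ z A B x = c * ((∫ s, A s) * ∫ t, B t) := by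
  let e : Plane ≃L[ℝ] ℝ × ℝ :=
    { toFun := fun x => (l₁ x, l₂ x)
      invFun := fun p => p.1 • b₁ + p.2 • b₂
      left_inv := h.reconstruct
      right_inv := fun p => by
        simp [h.apply₁₁, h.apply₁₂, h.apply₂₁, h.apply₂₂]
      map_add' := fun x y => by simp
      map_smul' := fun r x => by simp
      continuous_toFun := by fun_prop
      continuous_invFun := by fun_prop }
  have he : ∀ x, e x = (l₁ x, l₂ x) := fun x => rfl
  have := e.isAddHaarMeasure_map (volume : Measure Plane)
  set μ := Measure.map e (volume : Measure Plane) with hμ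
  obtain ⟨c, hc0, hsm⟩ : ∃ c : NNReal, 0 < c ∧ μ = c • (volume : Measure (ℝ × ℝ)) :=
    ⟨_, Measure.addHaarScalarFactor_pos_of_isAddHaarMeasure μ volume,
      Measure.isAddLeftInvariant_eq_smul μ volume⟩
  refine ⟨c, hc0, fun z => ?_, fun z A B => ?_⟩
  · have h1 : openParallelogram l₁ l₂ z = (fun x => x + -z) ⁻¹' (e ⁻¹' (Ioo 0 1 ×ˢ Ioo 0 1)) := by
      ext x
      simp [openParallelogram, he, sub_eq_add_neg]
    rw [h1, measure_preimage_add_right,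
      ← Measure.map_apply e.continuous.measurable (measurableSet_Ioo.prod measurableSet_Ioo), ← hμ]
    rw [hsm, Measure.smul_apply, Measure.volume_eq_prod, Measure.prod_prod, Real.volume_Ioo]
    simp [ENNReal.smul_def]
  · have h1 : ∫ x, obliqueTensor l₁ l₂ z A B x = ∫ x, A (l₁ x) * B (l₂ x) :=
      integral_sub_right_eq_self (fun x => A (l₁ x) * B (l₂ x)) z
    have h2 : ∫ x, A (l₁ x) * B (l₂ x) = ∫ p, A p.1 * B p.2 ∂μ :=
      (e.toHomeomorph.toMeasurableEquiv.measurableEmbedding.integral_map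
        (fun p : ℝ × ℝ => A p.1 * B p.2)).symm
    rw [h1, h2, hsm, integral_smul_nnreal_measure, Measure.volume_eq_prod, integral_prod_mul]
    rfl

theorem IsUnitBump.contDiff_obliqueTensor {A B : ℝ → ℝ} (hA : IsUnitBump A) (hB : IsUnitBump B)
    (l₁ l₂ : Plane →L[ℝ] ℝ) (z : Plane) : ContDiff ℝ ∞ (obliqueTensor l₁ l₂ z A B) :=
  (hA.contDiff.comp (l₁.contDiff.comp (contDiff_id.sub contDiff_const))).mul
    (hB.contDiff.comp (l₂.contDiff.comp (contDiff_id.sub contDiff_const)))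

theorem tsupport_obliqueTensor_subset (A B : ℝ → ℝ) (l₁ l₂ : Plane →L[ℝ] ℝ) (z : Plane) :
    tsupport (obliqueTensor l₁ l₂ z A B) ⊆
      {x | l₁ (x - z) ∈ tsupport A ∧ l₂ (x - z) ∈ tsupport B} := by
  refine closure_minimal (fun x hx => ⟨subset_tsupport _ (left_ne_zero_of_mul hx),
    subset_tsupport _ (right_ne_zero_of_mul hx)⟩) ?_
  exact ((isClosed_tsupport A).preimage (by fun_prop : Continuous fun x => l₁ (x - z))).inter
    ((isClosed_tsupport B).preimage (by fun_prop : Continuous fun x => l₂ (x - z)))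

theorem IsUnitBump.tsupport_obliqueTensor {A B : ℝ → ℝ} (hA : IsUnitBump A) (hB : IsUnitBump B)
    (l₁ l₂ : Plane →L[ℝ] ℝ) (z : Plane) :
    tsupport (obliqueTensor l₁ l₂ z A B) ⊆ openParallelogram l₁ l₂ z :=
  (tsupport_obliqueTensor_subset A B l₁ l₂ z).trans
    fun _ hx => ⟨hA.tsupport_subset hx.1, hB.tsupport_subset hx.2⟩

theorem IsDualFrame.hasCompactSupport_obliqueTensor {b₁ b₂ : Plane} {l₁ l₂ : Plane →L[ℝ] ℝ}
    (h : IsDualFrame b₁ b₂ l₁ l₂) {A B : ℝ → ℝ} (hA : IsUnitBump A) (hB : IsUnitBump B)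
    (z : Plane) : HasCompactSupport (obliqueTensor l₁ l₂ z A B) := by
  have hK : IsCompact ((fun p : ℝ × ℝ => z + (p.1 • b₁ + p.2 • b₂)) '' (tsupport A ×ˢ tsupport B)) :=
    (IsCompact.prod hA.hasCompactSupport hB.hasCompactSupport).image (by fun_prop)
  refine hK.of_isClosed_subset (isClosed_tsupport _) fun x hx => ?_
  have := tsupport_obliqueTensor_subset A B l₁ l₂ z hx
  exact ⟨(l₁ (x - z), l₂ (x - z)), ⟨this.1, this.2⟩, by simp only [h.reconstruct]; abel⟩

theorem IsUnitBump.partialDeriv_obliqueTensor {A B : ℝ → ℝ} (hA : IsUnitBump A)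
    (hB : IsUnitBump B) (l₁ l₂ : Plane →L[ℝ] ℝ) (z : Plane) (j : Fin 2) :
    partialDeriv j (obliqueTensor l₁ l₂ z A B) = fun x =>
      l₁ (EuclideanSpace.single j 1) * obliqueTensor l₁ l₂ z (deriv A) B x +
        l₂ (EuclideanSpace.single j 1) * obliqueTensor l₁ l₂ z A (deriv B) x := by
  ext x
  have key : ∀ (C : ℝ → ℝ) (l : Plane →L[ℝ] ℝ), IsUnitBump C →
      HasFDerivAt (fun x => C (l (x - z))) (deriv C (l (x - z)) • l) x := by
    intro C l hC
    have h1 : HasFDerivAt (fun x => l (x - z)) l x :=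
      l.hasFDerivAt.comp x ((hasFDerivAt_id x).sub_const z)
    exact (hC.contDiff.differentiable (by simp) _).hasDerivAt.comp_hasFDerivAt x h1
  have h := ((key A l₁ hA).mul (key B l₂ hB)).fderiv
  unfold partialDeriv
  rw [show obliqueTensor l₁ l₂ z A B = (fun x => A (l₁ (x - z))) * fun x => B (l₂ (x - z)) from rfl,
    h]
  simp only [obliqueTensor, add_apply, smul_apply,
    smul_eq_mul]
  ring

theorem Plane.map_eq_sum (l : Plane →L[ℝ] ℝ) (b : Plane) :
    l b = b 0 * l (EuclideanSpace.single 0 1) + b 1 * l (EuclideanSpace.single 1 1) := by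
  have h : b = b 0 • EuclideanSpace.single 0 (1 : ℝ) + b 1 • EuclideanSpace.single 1 (1 : ℝ) := by
    ext j; fin_cases j <;> simp
  conv_lhs => rw [h]
  simp

/-! ### Integration by parts along the frame directions -/

section WeakOblique

variable {b₁ b₂ : Plane} {l₁ l₂ : Plane →L[ℝ] ℝ} {z : Plane} {G : Set Plane} {v : Plane → ℝ}
  {A B : ℝ → ℝ}

theorem integrable_mul_obliqueTensor (h : IsDualFrame b₁ b₂ l₁ l₂)
    (hPG : openParallelogram l₁ l₂ z ⊆ G) (hv : LocallyIntegrableOn v G)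
    (hA : IsUnitBump A) (hB : IsUnitBump B) :
    Integrable (fun x => v x * obliqueTensor l₁ l₂ z A B x) :=
  hv.integrableOn_mul_of_tsupport_subset (hA.contDiff_obliqueTensor hB l₁ l₂ z).continuous
    (h.hasCompactSupport_obliqueTensor hA hB z) ((hA.tsupport_obliqueTensor hB l₁ l₂ z).trans hPG)

/-- `A' ⊗ B` is the derivative of `A ⊗ B` along `b₁`, because `l₁ b₁ = 1` and `l₂ b₁ = 0`; expanding
`b₁` in Cartesian components turns this into two weak derivatives. -/
theorem integral_mul_obliqueTensor_deriv_left (h : IsDualFrame b₁ b₂ l₁ l₂)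
    (hPG : openParallelogram l₁ l₂ z ⊆ G) {g₁₀ g₀₁ : Plane → ℝ}
    (h₁₀ : HasWeakDeriv G (1, 0) v g₁₀) (h₀₁ : HasWeakDeriv G (0, 1) v g₀₁)
    (hA : IsUnitBump A) (hB : IsUnitBump B) :
    ∫ x in G, v x * obliqueTensor l₁ l₂ z (deriv A) B x =
      -(b₁ 0 * ∫ x in G, g₁₀ x * obliqueTensor l₁ l₂ z A B x) -
        b₁ 1 * ∫ x in G, g₀₁ x * obliqueTensor l₁ l₂ z A B x := by
  have hs := (hA.tsupport_obliqueTensor hB l₁ l₂ z).trans hPG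
  have hc := h.hasCompactSupport_obliqueTensor hA hB z
  have hd := hA.contDiff_obliqueTensor hB l₁ l₂ z
  have e₁ := h₁₀.2.2 _ hd hc hs
  have e₂ := h₀₁.2.2 _ hd hc hs
  have i : ∀ j, Integrable (fun x => v x * partialDeriv j (obliqueTensor l₁ l₂ z A B) x) :=
    fun j => h₁₀.1.integrableOn_mul_of_tsupport_subset (hd.partialDeriv j).continuous
      (hc.of_isClosed_subset (isClosed_tsupport _) (tsupport_partialDeriv_subset j _))
      ((tsupport_partialDeriv_subset j _).trans hs)
  rw [multiDeriv_one_zero] at e₁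
  rw [multiDeriv_zero_one] at e₂
  have key : ∀ x, v x * obliqueTensor l₁ l₂ z (deriv A) B x =
      b₁ 0 * (v x * partialDeriv 0 (obliqueTensor l₁ l₂ z A B) x) +
      b₁ 1 * (v x * partialDeriv 1 (obliqueTensor l₁ l₂ z A B) x) := by
    intro x
    have r₁ := h.apply₁₁
    have r₂ := h.apply₂₁
    rw [Plane.map_eq_sum] at r₁ r₂
    simp only [hA.partialDeriv_obliqueTensor hB]
    linear_combination (-v x * obliqueTensor l₁ l₂ z (deriv A) B x) * r₁ -
      (v x * obliqueTensor l₁ l₂ z A (deriv B) x) * r₂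
  simp only [key]
  rw [integral_add ((i 0).integrableOn.const_mul _) ((i 1).integrableOn.const_mul _),
    integral_const_mul, integral_const_mul, e₁, e₂]
  ring

theorem integral_mul_obliqueTensor_deriv_right (h : IsDualFrame b₁ b₂ l₁ l₂)
    (hPG : openParallelogram l₁ l₂ z ⊆ G) {g₁₀ g₀₁ : Plane → ℝ}
    (h₁₀ : HasWeakDeriv G (1, 0) v g₁₀) (h₀₁ : HasWeakDeriv G (0, 1) v g₀₁)
    (hA : IsUnitBump A) (hB : IsUnitBump B) :
    ∫ x in G, v x * obliqueTensor l₁ l₂ z A (deriv B) x =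
      -(b₂ 0 * ∫ x in G, g₁₀ x * obliqueTensor l₁ l₂ z A B x) -
        b₂ 1 * ∫ x in G, g₀₁ x * obliqueTensor l₁ l₂ z A B x := by
  -- The two frame directions play symmetric roles, so the previous case applies after exchanging
  -- them.
  have hswap : ∀ C D, obliqueTensor l₁ l₂ z C D = obliqueTensor l₂ l₁ z D C := fun C D => by
    ext x; exact mul_comm _ _
  have h' : IsDualFrame b₂ b₁ l₂ l₁ := ⟨h.apply₂₂, h.apply₂₁, h.apply₁₂, h.apply₁₁,
    fun x => by rw [add_comm]; exact h.reconstruct x⟩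
  rw [hswap, hswap]
  exact integral_mul_obliqueTensor_deriv_left h' (fun x hx => hPG hx.symm) h₁₀ h₀₁ hB hA

/-- `A' ⊗ B'` is the mixed derivative of `A ⊗ B` along `b₁` and `b₂`; the coefficients are those of
the product of the two directional derivatives. -/
theorem integral_mul_obliqueTensor_deriv_deriv (h : IsDualFrame b₁ b₂ l₁ l₂)
    (hPG : openParallelogram l₁ l₂ z ⊆ G) {g₂₀ g₁₁ g₀₂ : Plane → ℝ}
    (h₂₀ : HasWeakDeriv G (2, 0) v g₂₀) (h₁₁ : HasWeakDeriv G (1, 1) v g₁₁)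
    (h₀₂ : HasWeakDeriv G (0, 2) v g₀₂) (hA : IsUnitBump A) (hB : IsUnitBump B) :
    ∫ x in G, v x * obliqueTensor l₁ l₂ z (deriv A) (deriv B) x =
      b₁ 0 * b₂ 0 * (∫ x in G, g₂₀ x * obliqueTensor l₁ l₂ z A B x) +
      (b₁ 0 * b₂ 1 + b₁ 1 * b₂ 0) * (∫ x in G, g₁₁ x * obliqueTensor l₁ l₂ z A B x) +
      b₁ 1 * b₂ 1 * ∫ x in G, g₀₂ x * obliqueTensor l₁ l₂ z A B x := by
  have hs := (hA.tsupport_obliqueTensor hB l₁ l₂ z).trans hPG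
  have hc := h.hasCompactSupport_obliqueTensor hA hB z
  have hd := hA.contDiff_obliqueTensor hB l₁ l₂ z
  have e₁ := h₂₀.2.2 _ hd hc hs
  have e₂ := h₁₁.2.2 _ hd hc hs
  have e₃ := h₀₂.2.2 _ hd hc hs
  have i : ∀ ν, Integrable (fun x => v x * multiDeriv ν (obliqueTensor l₁ l₂ z A B) x) :=
    fun ν => h₁₁.1.integrableOn_mul_of_tsupport_subset (hd.multiDeriv ν).continuous
      (hc.of_isClosed_subset (isClosed_tsupport _) (tsupport_multiDeriv_subset ν _))
      ((tsupport_multiDeriv_subset ν _).trans hs)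
  have hadd : ∀ (j : Fin 2) (c d : ℝ) (f₁ f₂ : Plane → ℝ), ContDiff ℝ ∞ f₁ → ContDiff ℝ ∞ f₂ →
      ∀ x, partialDeriv j (fun x => c * f₁ x + d * f₂ x) x =
        c * partialDeriv j f₁ x + d * partialDeriv j f₂ x := by
    intro j c d f₁ f₂ hf₁ hf₂ x
    have d₁ := (hf₁.differentiable (by simp) x).hasFDerivAt
    have d₂ := (hf₂.differentiable (by simp) x).hasFDerivAt
    have := ((d₁.const_mul c).add (d₂.const_mul d)).fderiv
    unfold partialDeriv
    rw [show (fun x => c * f₁ x + d * f₂ x) = (fun x => c * f₁ x) + fun x => d * f₂ x from rfl,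
      this]
    simp
  have second : ∀ (j p : Fin 2) x, partialDeriv j (partialDeriv p (obliqueTensor l₁ l₂ z A B)) x =
      l₁ (EuclideanSpace.single p 1) *
        (l₁ (EuclideanSpace.single j 1) * obliqueTensor l₁ l₂ z (deriv (deriv A)) B x +
          l₂ (EuclideanSpace.single j 1) * obliqueTensor l₁ l₂ z (deriv A) (deriv B) x) +
      l₂ (EuclideanSpace.single p 1) *
        (l₁ (EuclideanSpace.single j 1) * obliqueTensor l₁ l₂ z (deriv A) (deriv B) x +
          l₂ (EuclideanSpace.single j 1) * obliqueTensor l₁ l₂ z A (deriv (deriv B)) x) := by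
    intro j p x
    rw [hA.partialDeriv_obliqueTensor hB,
      hadd _ _ _ _ _ ((isUnitBump_deriv hA).contDiff_obliqueTensor hB l₁ l₂ z)
        (hA.contDiff_obliqueTensor (isUnitBump_deriv hB) l₁ l₂ z),
      (isUnitBump_deriv hA).partialDeriv_obliqueTensor hB,
      hA.partialDeriv_obliqueTensor (isUnitBump_deriv hB)]
  have key : ∀ x, v x * obliqueTensor l₁ l₂ z (deriv A) (deriv B) x =
      b₁ 0 * b₂ 0 * (v x * multiDeriv (2, 0) (obliqueTensor l₁ l₂ z A B) x) +
      (b₁ 0 * b₂ 1 + b₁ 1 * b₂ 0) * (v x * multiDeriv (1, 1) (obliqueTensor l₁ l₂ z A B) x) +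
      b₁ 1 * b₂ 1 * (v x * multiDeriv (0, 2) (obliqueTensor l₁ l₂ z A B) x) := by
    intro x
    have r₁₁ := h.apply₁₁
    have r₁₂ := h.apply₁₂
    have r₂₁ := h.apply₂₁
    have r₂₂ := h.apply₂₂
    have m₂₀ : multiDeriv (2, 0) (obliqueTensor l₁ l₂ z A B) x =
      partialDeriv 0 (partialDeriv 0 (obliqueTensor l₁ l₂ z A B)) x := rfl
    have m₁₁ : multiDeriv (1, 1) (obliqueTensor l₁ l₂ z A B) x =
      partialDeriv 0 (partialDeriv 1 (obliqueTensor l₁ l₂ z A B)) x := rfl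
    have m₀₂ : multiDeriv (0, 2) (obliqueTensor l₁ l₂ z A B) x =
      partialDeriv 1 (partialDeriv 1 (obliqueTensor l₁ l₂ z A B)) x := rfl
    rw [m₂₀, m₁₁, m₀₂, second, second, second]
    set X := obliqueTensor l₁ l₂ z (deriv (deriv A)) B x
    set Y := obliqueTensor l₁ l₂ z (deriv A) (deriv B) x
    set Z := obliqueTensor l₁ l₂ z A (deriv (deriv B)) x
    -- The zeros and ones of the dual frame are written back as values `l b`; expanding these in
    -- components makes the claim a polynomial identity.
    have : v x * Y = v x * ((l₁ b₁ * l₁ b₂) * X + (l₁ b₁ * l₂ b₂ + l₂ b₁ * l₁ b₂) * Y +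
        (l₂ b₁ * l₂ b₂) * Z) := by
      rw [r₁₁, r₁₂, r₂₁, r₂₂]; ring
    rw [this]
    simp only [Plane.map_eq_sum l₁ b₁, Plane.map_eq_sum l₁ b₂, Plane.map_eq_sum l₂ b₁,
      Plane.map_eq_sum l₂ b₂]
    ring
  simp only [key]
  have i₁₂ : IntegrableOn (fun x =>
      b₁ 0 * b₂ 0 * (v x * multiDeriv (2, 0) (obliqueTensor l₁ l₂ z A B) x) +
      (b₁ 0 * b₂ 1 + b₁ 1 * b₂ 0) *
        (v x * multiDeriv (1, 1) (obliqueTensor l₁ l₂ z A B) x)) G :=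
    ((i _).integrableOn.const_mul _).add ((i _).integrableOn.const_mul _)
  rw [integral_add i₁₂ ((i _).integrableOn.const_mul _),
    integral_add ((i _).integrableOn.const_mul _) ((i _).integrableOn.const_mul _),
    integral_const_mul, integral_const_mul, integral_const_mul, e₁, e₂, e₃]
  norm_num

theorem abs_integral_mul_obliqueTensor_le (hPG : openParallelogram l₁ l₂ z ⊆ G) {g : Plane → ℝ}
    (hg : IntegrableOn g (openParallelogram l₁ l₂ z)) (hA : IsUnitBump A) (hB : IsUnitBump B)
    {M : ℝ} (hM : ∀ s t, |A s * B t| ≤ M) :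
    |∫ x in G, g x * obliqueTensor l₁ l₂ z A B x| ≤
      M * ∫ x in openParallelogram l₁ l₂ z, |g x| := by
  have hs := hA.tsupport_obliqueTensor hB l₁ l₂ z
  rw [setIntegral_mul_eq_integral (hs.trans hPG), ← setIntegral_mul_eq_integral hs,
    ← integral_const_mul, ← Real.norm_eq_abs]
  refine norm_integral_le_of_norm_le (hg.abs.const_mul M) (Filter.Eventually.of_forall fun x => ?_)
  rw [norm_mul, mul_comm]
  exact mul_le_mul_of_nonneg_right (hM _ _) (abs_nonneg _)

end WeakOblique

/-! ### Pointwise bounds by weak derivatives of order at most two -/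

theorem abs_signed_sum_le {x₁ x₂ x₃ x₄ x₅ x₆ x₇ x₈ a₁ a₂ a₃ a₄ a₅ a₆ a₇ a₈ : ℝ}
    (h₁ : |x₁| ≤ a₁) (h₂ : |x₂| ≤ a₂) (h₃ : |x₃| ≤ a₃) (h₄ : |x₄| ≤ a₄) (h₅ : |x₅| ≤ a₅)
    (h₆ : |x₆| ≤ a₆) (h₇ : |x₇| ≤ a₇) (h₈ : |x₈| ≤ a₈) :
    |x₁ + (-x₂ - x₃) + (-x₄ - x₅) + (x₆ + x₇ + x₈)| ≤
      a₁ + a₂ + a₃ + a₄ + a₅ + a₆ + a₇ + a₈ := by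
  rw [abs_le] at *
  constructor <;> linarith

/-- The pairing of a function with an approximate identity at the corner of a parallelogram is
bounded by its weak derivatives of order at most two. -/
theorem abs_integral_mul_approx_le {K₂ : ℝ} (hK₂1 : 1 ≤ K₂)
    (hbK : ∀ s, |deriv (smoothStep (1 / 3)) s| ≤ K₂) {b₁ b₂ : Plane} {l₁ l₂ : Plane →L[ℝ] ℝ}
    (h : IsDualFrame b₁ b₂ l₁ l₂) {β : ℝ} (hβ₁ : ∀ j, |b₁ j| ≤ β) (hβ₂ : ∀ j, |b₂ j| ≤ β)
    {z : Plane} {G : Set Plane} {v : Plane → ℝ} {g : ℕ × ℕ → Plane → ℝ}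
    (hPG : openParallelogram l₁ l₂ z ⊆ G)
    (hw : ∀ ν : ℕ × ℕ, ν.1 + ν.2 ≤ 2 → HasWeakDeriv G ν v (g ν))
    (hi : ∀ ν : ℕ × ℕ, ν.1 + ν.2 ≤ 2 → IntegrableOn (g ν) (openParallelogram l₁ l₂ z))
    {δ : ℝ} (hδ : 0 < δ) (hδ' : δ ≤ 1 / 3) :
    |∫ x in G, v x * obliqueTensor l₁ l₂ z (deriv (smoothStep δ)) (deriv (smoothStep δ)) x| ≤
      2 * K₂ ^ 2 * ∑ l ∈ Finset.range 3, ∑ ν ∈ Finset.HasAntidiagonal.antidiagonal l,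
        β ^ l * ∫ x in openParallelogram l₁ l₂ z, |g ν x| := by
  have hb : IsUnitBump (deriv (smoothStep (1 / 3))) :=
    isUnitBump_deriv_smoothStep (by norm_num) le_rfl
  have hβ0 : 0 ≤ β := (abs_nonneg _).trans (hβ₁ 0)
  obtain ⟨J, hJ⟩ : ∃ J : ℕ × ℕ → ℝ, ∀ ν, J ν = ∫ x in openParallelogram l₁ l₂ z, |g ν x| :=
    ⟨_, fun _ => rfl⟩
  have hJ0 : ∀ ν, 0 ≤ J ν := fun ν => by rw [hJ]; exact integral_nonneg fun x => abs_nonneg _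
  have hbound : ∀ {ν : ℕ × ℕ} {A B : ℝ → ℝ} {M : ℝ}, ν.1 + ν.2 ≤ 2 → IsUnitBump A →
      IsUnitBump B → (∀ s t, |A s * B t| ≤ M) →
      |∫ x in G, g ν x * obliqueTensor l₁ l₂ z A B x| ≤ M * J ν := fun hν hA hB hM => by
    rw [hJ]; exact abs_integral_mul_obliqueTensor_le hPG (hi _ hν) hA hB hM
  simp only [← hJ]
  have hR : ∑ l ∈ Finset.range 3, ∑ ν ∈ Finset.HasAntidiagonal.antidiagonal l, β ^ l * J ν =
      J (0, 0) + (β * J (0, 1) + β * J (1, 0)) +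
        (β ^ 2 * J (0, 2) + β ^ 2 * J (1, 1) + β ^ 2 * J (2, 0)) := by
    simp [Finset.sum_range_succ, Finset.Nat.antidiagonal_succ]
    ring
  -- The approximate identity is split as `b + η'` with `b` independent of `δ` and `|η| ≤ 1`. Once
  -- the derivatives of `η` have been moved onto `v`, nothing left depends on `δ` except through
  -- `η`, so the bound is uniform.
  set η : ℝ → ℝ := fun s => smoothStep δ s - smoothStep (1 / 3) s with hη
  set b : ℝ → ℝ := deriv (smoothStep (1 / 3)) with hbdef
  have hηb : IsUnitBump η := isUnitBump_smoothStep_sub hδ hδ'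
  have hη1 : ∀ s, |η s| ≤ 1 := fun s => by
    rw [abs_le]
    constructor <;>
      linarith [smoothStep_nonneg δ s, smoothStep_nonneg (1 / 3) s, smoothStep_le_one δ s,
        smoothStep_le_one (1 / 3) s]
  have hαs : ∀ s, deriv (smoothStep δ) s = b s + deriv η s := by
    intro s
    have : deriv η s = deriv (smoothStep δ) s - b s :=
      deriv_fun_sub ((contDiff_smoothStep δ).differentiable (by simp) s)
        ((contDiff_smoothStep _).differentiable (by simp) s)
    rw [this]; ring
  have hv : LocallyIntegrableOn v G := (hw (0, 0) (by simp)).1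
  have hηη := isUnitBump_deriv hηb
  have split : ∫ x in G, v x *
        obliqueTensor l₁ l₂ z (deriv (smoothStep δ)) (deriv (smoothStep δ)) x =
      (∫ x in G, v x * obliqueTensor l₁ l₂ z b b x) +
      (∫ x in G, v x * obliqueTensor l₁ l₂ z (deriv η) b x) +
      (∫ x in G, v x * obliqueTensor l₁ l₂ z b (deriv η) x) +
      ∫ x in G, v x * obliqueTensor l₁ l₂ z (deriv η) (deriv η) x := by
    have i₁ := (integrable_mul_obliqueTensor h hPG hv hb hb).integrableOn (s := G)
    have i₂ := (integrable_mul_obliqueTensor h hPG hv hηη hb).integrableOn (s := G)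
    have i₃ := (integrable_mul_obliqueTensor h hPG hv hb hηη).integrableOn (s := G)
    have i₄ := (integrable_mul_obliqueTensor h hPG hv hηη hηη).integrableOn (s := G)
    rw [← integral_add' i₁ i₂, ← integral_add' (i₁.add i₂) i₃,
      ← integral_add' ((i₁.add i₂).add i₃) i₄]
    congr 1
    ext x
    simp only [obliqueTensor, hαs, Pi.add_apply]
    ring
  have t₁ : ∫ x in G, v x * obliqueTensor l₁ l₂ z b b x =
      ∫ x in G, g (0, 0) x * obliqueTensor l₁ l₂ z b b x := by
    have := (hw (0, 0) (by simp)).2.2 _ (hb.contDiff_obliqueTensor hb l₁ l₂ z)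
      (h.hasCompactSupport_obliqueTensor hb hb z)
      ((hb.tsupport_obliqueTensor hb l₁ l₂ z).trans hPG)
    simpa [multiDeriv_zero] using this
  have t₂ := integral_mul_obliqueTensor_deriv_left h hPG (hw (1, 0) (by simp))
    (hw (0, 1) (by simp)) hηb hb
  have t₃ := integral_mul_obliqueTensor_deriv_right h hPG (hw (1, 0) (by simp))
    (hw (0, 1) (by simp)) hb hηb
  have t₄ := integral_mul_obliqueTensor_deriv_deriv h hPG (hw (2, 0) (by simp))
    (hw (1, 1) (by simp)) (hw (0, 2) (by simp)) hηb hηb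
  rw [split, t₁, t₂, t₃, t₄]
  have bb : ∀ s t, |b s * b t| ≤ K₂ ^ 2 := fun s t => by
    rw [abs_mul, sq]; exact mul_le_mul (hbK s) (hbK t) (abs_nonneg _) (by linarith)
  have ηb : ∀ s t, |η s * b t| ≤ K₂ := fun s t => by
    rw [abs_mul, ← one_mul K₂]; exact mul_le_mul (hη1 s) (hbK t) (abs_nonneg _) (by linarith)
  have bη : ∀ s t, |b s * η t| ≤ K₂ := fun s t => by rw [mul_comm]; exact ηb t s
  have ηη : ∀ s t, |η s * η t| ≤ 1 := fun s t => by
    rw [abs_mul, ← one_mul (1 : ℝ)]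
    exact mul_le_mul (hη1 s) (hη1 t) (abs_nonneg _) (by linarith)
  have e₁ := hbound (ν := (0, 0)) (by simp) hb hb bb
  have e₂ := hbound (ν := (1, 0)) (by simp) hηb hb ηb
  have e₃ := hbound (ν := (0, 1)) (by simp) hηb hb ηb
  have e₄ := hbound (ν := (1, 0)) (by simp) hb hηb bη
  have e₅ := hbound (ν := (0, 1)) (by simp) hb hηb bη
  have e₆ := hbound (ν := (2, 0)) (by simp) hηb hηb ηη
  have e₇ := hbound (ν := (1, 1)) (by simp) hηb hηb ηη
  have e₈ := hbound (ν := (0, 2)) (by simp) hηb hηb ηη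
  have mulb : ∀ {p q I j : ℝ}, |p| ≤ q → |I| ≤ j → |p * I| ≤ q * j := fun hp hI => by
    rw [abs_mul]; exact mul_le_mul hp hI (abs_nonneg _) ((abs_nonneg _).trans hp)
  have ββ : ∀ j p, |b₁ j * b₂ p| ≤ β ^ 2 := fun j p => by
    rw [sq]; exact mulb (hβ₁ j) (hβ₂ p)
  have m₂ := mulb (hβ₁ 0) e₂
  have m₃ := mulb (hβ₁ 1) e₃
  have m₄ := mulb (hβ₂ 0) e₄
  have m₅ := mulb (hβ₂ 1) e₅
  have m₆ := mulb (ββ 0 0) e₆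
  have m₇ := mulb ((abs_add_le _ _).trans (add_le_add (ββ 0 1) (ββ 1 0))) e₇
  have m₈ := mulb (ββ 1 1) e₈
  -- The terms carry `K₂ ^ 2`, `K₂` or 1, all at most `K₂ ^ 2`. The factor 2 in the claim covers the
  -- first derivatives, which occur twice, and the mixed second derivative, whose coefficient is
  -- only bounded by `2 * β ^ 2`.
  have hK : K₂ ≤ K₂ ^ 2 := by nlinarith
  have hK' : 1 ≤ K₂ ^ 2 := by nlinarith
  have hβJ : ∀ ν, K₂ * (β * J ν) ≤ K₂ ^ 2 * (β * J ν) := fun ν =>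
    mul_le_mul_of_nonneg_right hK (mul_nonneg hβ0 (hJ0 ν))
  have hβJ' : ∀ ν, β ^ 2 * J ν ≤ K₂ ^ 2 * (β ^ 2 * J ν) := fun ν =>
    le_mul_of_one_le_left (mul_nonneg (by positivity) (hJ0 ν)) hK'
  have n₁ : β * (K₂ * J (1, 0)) ≤ K₂ ^ 2 * (β * J (1, 0)) := by
    rw [mul_left_comm]; exact hβJ _
  have n₂ : β * (K₂ * J (0, 1)) ≤ K₂ ^ 2 * (β * J (0, 1)) := by
    rw [mul_left_comm]; exact hβJ _
  have n₃ := hβJ' (2, 0)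
  have n₄ := hβJ' (1, 1)
  have n₅ := hβJ' (0, 2)
  have n₀ : 0 ≤ K₂ ^ 2 * J (0, 0) := mul_nonneg (by positivity) (hJ0 _)
  have n₆ : 0 ≤ K₂ ^ 2 * (β ^ 2 * J (2, 0)) :=
    mul_nonneg (by positivity) (mul_nonneg (by positivity) (hJ0 _))
  have n₇ : 0 ≤ K₂ ^ 2 * (β ^ 2 * J (0, 2)) :=
    mul_nonneg (by positivity) (mul_nonneg (by positivity) (hJ0 _))
  refine (abs_signed_sum_le e₁ m₂ m₃ m₄ m₅ m₆ m₇ m₈).trans ?_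
  rw [hR]
  linarith

/-- Pointwise bound at the corner of a parallelogram by the weak derivatives of order at most two
on the parallelogram. -/
theorem exists_pointwise_bound : ∃ K : ℝ, 0 < K ∧
    ∀ (b₁ b₂ : Plane) (l₁ l₂ : Plane →L[ℝ] ℝ), IsDualFrame b₁ b₂ l₁ l₂ →
    ∀ (β : ℝ), (∀ j, |b₁ j| ≤ β) → (∀ j, |b₂ j| ≤ β) →
    ∀ (z : Plane) (G : Set Plane) (v u : Plane → ℝ) (g : ℕ × ℕ → Plane → ℝ),
    openParallelogram l₁ l₂ z ⊆ G →
    (∀ ν : ℕ × ℕ, ν.1 + ν.2 ≤ 2 → HasWeakDeriv G ν v (g ν)) →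
    (∀ ν : ℕ × ℕ, ν.1 + ν.2 ≤ 2 → IntegrableOn (g ν) (openParallelogram l₁ l₂ z)) →
    ContinuousWithinAt u (openParallelogram l₁ l₂ z) z →
    u =ᵐ[volume.restrict (openParallelogram l₁ l₂ z)] v →
    |u z| * volume.real (openParallelogram l₁ l₂ z) ≤
      K * ∑ l ∈ Finset.range 3, ∑ ν ∈ Finset.HasAntidiagonal.antidiagonal l,
        β ^ l * ∫ x in openParallelogram l₁ l₂ z, |g ν x| := by
  have hb : IsUnitBump (deriv (smoothStep (1 / 3))) :=
    isUnitBump_deriv_smoothStep (by norm_num) le_rfl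
  obtain ⟨K₁, hK₁⟩ := hb.contDiff.continuous.bounded_above_of_compact_support hb.hasCompactSupport
  -- The summand 1 ensures `1 ≤ K₂`, so that powers of `K₂` can be compared.
  set K₂ : ℝ := 1 + |K₁| with hK₂
  have hK₂1 : 1 ≤ K₂ := by simp [hK₂]
  have hbK : ∀ s, |deriv (smoothStep (1 / 3)) s| ≤ K₂ := fun s => by
    have := hK₁ s
    rw [Real.norm_eq_abs] at this
    linarith [le_abs_self K₁]
  refine ⟨2 * K₂ ^ 2, by positivity, ?_⟩
  intro b₁ b₂ l₁ l₂ h β hβ₁ hβ₂ z G v u g hPG hw hi hu huv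
  set P := openParallelogram l₁ l₂ z with hP
  obtain ⟨c, hc0, hcv, hcI⟩ := h.exists_jacobian
  have hvol : volume.real P = c := by
    rw [measureReal_def, hcv, ENNReal.toReal_ofReal hc0.le]
  set R := ∑ l ∈ Finset.range 3, ∑ ν ∈ Finset.HasAntidiagonal.antidiagonal l,
    β ^ l * ∫ x in P, |g ν x|
  rw [hvol]
  refine le_of_forall_pos_le_add fun ε hε => ?_
  -- continuity of `u` at the corner
  obtain ⟨r, hr, hru⟩ := Metric.continuousWithinAt_iff.1 hu (ε / c) (by positivity)
  -- The test function lives where both coordinates are in `[δ, 2δ]`; this choice puts that set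
  -- within distance `r` of the corner `z`.
  obtain ⟨δ, hδ, hδ', hδr⟩ : ∃ δ : ℝ, 0 < δ ∧ δ ≤ 1 / 3 ∧ 2 * δ * (‖b₁‖ + ‖b₂‖) < r := by
    refine ⟨min (1 / 3) (r / (4 * (‖b₁‖ + ‖b₂‖ + 1))), by positivity, min_le_left _ _, ?_⟩
    have hS : 0 ≤ ‖b₁‖ + ‖b₂‖ := by positivity
    have h1 := min_le_right (1 / 3) (r / (4 * (‖b₁‖ + ‖b₂‖ + 1)))
    set S := ‖b₁‖ + ‖b₂‖
    calc 2 * min (1 / 3) (r / (4 * (S + 1))) * S ≤ 2 * (r / (4 * (S + 1))) * S := by gcongr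
      _ = (r / 2) * (S / (S + 1)) := by field_simp; ring
      _ ≤ (r / 2) * 1 := by
        gcongr
        rw [div_le_one (by positivity)]; linarith
      _ < r := by linarith
  set α := deriv (smoothStep δ) with hα
  have hαb : IsUnitBump α := isUnitBump_deriv_smoothStep hδ hδ'
  have hα0 : ∀ s, 0 ≤ α s := deriv_smoothStep_nonneg hδ
  set φ := obliqueTensor l₁ l₂ z α α with hφ
  have hφ0 : ∀ x, 0 ≤ φ x := fun x => mul_nonneg (hα0 _) (hα0 _)
  have hφs : tsupport φ ⊆ P := hαb.tsupport_obliqueTensor hαb l₁ l₂ z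
  have hφI : ∫ x, φ x = c := by
    rw [hcI, integral_deriv_smoothStep hδ]; ring
  have hφint : Integrable φ := (hαb.contDiff_obliqueTensor hαb l₁ l₂ z).continuous.integrable_of_hasCompactSupport
    (h.hasCompactSupport_obliqueTensor hαb hαb z)
  have hv : LocallyIntegrableOn v G := (hw (0, 0) (by simp)).1
  have e₁ : ∫ x in G, v x * φ x = ∫ x in P, u x * φ x := by
    rw [setIntegral_mul_eq_integral (hφs.trans hPG), ← setIntegral_mul_eq_integral hφs]
    refine integral_congr_ae ?_
    filter_upwards [huv] with x hx
    rw [hx]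
  have hvi : IntegrableOn (fun x => u x * φ x) P := by
    refine (integrable_mul_obliqueTensor h hPG hv hαb hαb).integrableOn.congr ?_
    filter_upwards [huv] with x hx
    rw [hx]
  have hmeas : MeasurableSet P := (isOpen_openParallelogram l₁ l₂ z).measurableSet
  -- `φ` is nonnegative with mass `c`, so its pairing with `u` differs from `u z * c` by at most `c`
  -- times the oscillation `ε / c`.
  have e₂ : |(∫ x in P, u x * φ x) - u z * c| ≤ ε := by
    have hzI : ∫ x in P, u z * φ x = u z * c := by
      rw [integral_const_mul, ← hφI]
      congr 1
      exact setIntegral_eq_integral_of_forall_compl_eq_zero fun x hx =>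
        image_eq_zero_of_notMem_tsupport fun hx' => hx (hφs hx')
    rw [← hzI, ← integral_sub hvi (hφint.integrableOn.const_mul _), ← Real.norm_eq_abs]
    have hle : ∀ᵐ x ∂(volume.restrict P), ‖u x * φ x - u z * φ x‖ ≤ ε / c * φ x := by
      rw [ae_restrict_iff' hmeas]
      refine Filter.Eventually.of_forall fun x hx => ?_
      rw [← sub_mul, norm_mul, Real.norm_of_nonneg (hφ0 x)]
      by_cases hφx : φ x = 0
      · rw [hφx, mul_zero, mul_zero]
      · refine mul_le_mul_of_nonneg_right ?_ (hφ0 x)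
        have s₁ : l₁ (x - z) ∈ Icc δ (2 * δ) := by
          by_contra hs
          exact hφx (mul_eq_zero_of_left (deriv_smoothStep_eq_zero hδ hs) _)
        have s₂ : l₂ (x - z) ∈ Icc δ (2 * δ) := by
          by_contra hs
          exact hφx (mul_eq_zero_of_right _ (deriv_smoothStep_eq_zero hδ hs))
        refine (hru hx ?_).le
        rw [dist_eq_norm, ← h.reconstruct (x - z)]
        refine lt_of_le_of_lt (norm_add_le _ _) (lt_of_le_of_lt ?_ hδr)
        rw [norm_smul, norm_smul, Real.norm_of_nonneg (hδ.le.trans s₁.1),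
          Real.norm_of_nonneg (hδ.le.trans s₂.1), mul_add]
        gcongr
        · exact s₁.2
        · exact s₂.2
    refine (norm_integral_le_of_norm_le (hφint.integrableOn.const_mul _) hle).trans ?_
    rw [integral_const_mul]
    have : ∫ x in P, φ x = c := by
      rw [← hφI]
      exact setIntegral_eq_integral_of_forall_compl_eq_zero fun x hx =>
        image_eq_zero_of_notMem_tsupport fun hx' => hx (hφs hx')
    rw [this, div_mul_cancel₀ _ hc0.ne']
  have m := abs_integral_mul_approx_le hK₂1 hbK h hβ₁ hβ₂ hPG hw hi hδ hδ'
  rw [e₁] at m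
  have : |u z| * c = |u z * c| := by rw [abs_mul, abs_of_pos hc0]
  rw [this]
  have tri := abs_sub_abs_le_abs_sub (u z * c) (∫ x in P, u x * φ x)
  rw [abs_sub_comm] at tri
  linarith

/-! ### Lagrange interpolation on a triangle -/

/-- The polynomial function on the plane. -/
noncomputable def polyFun (p : MvPolynomial (Fin 2) ℝ) : Plane → ℝ :=
  fun x => MvPolynomial.eval (fun j => x j) p

theorem contDiff_polyFun (p : MvPolynomial (Fin 2) ℝ) : ContDiff ℝ ∞ (polyFun p) := by
  induction p using MvPolynomial.induction_on with
  | C a =>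
    rw [show polyFun (MvPolynomial.C a) = fun _ => a by ext x; simp [polyFun]]
    exact contDiff_const
  | add p q hp hq =>
    rw [show polyFun (p + q) = fun x => polyFun p x + polyFun q x by ext x; simp [polyFun]]
    exact hp.add hq
  | mul_X p j hp =>
    have hj : ContDiff ℝ ∞ (fun x : Plane => x j) := by fun_prop
    rw [show polyFun (p * MvPolynomial.X j) = fun x => polyFun p x * x j by ext x; simp [polyFun]]
    exact hp.mul hj

theorem polyFun_aeval (f : Fin 2 → MvPolynomial (Fin 2) ℝ) (p : MvPolynomial (Fin 2) ℝ)
    (x y : Plane) (h : ∀ i, polyFun (f i) x = y i) :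
    polyFun (MvPolynomial.aeval f p) x = polyFun p y := by
  simp only [polyFun] at *
  induction p using MvPolynomial.induction_on with
  | C a => simp
  | add p q hp hq => simp only [map_add, hp, hq]
  | mul_X p j hp => simp only [map_mul, hp, MvPolynomial.aeval_X, h, MvPolynomial.eval_X]

theorem MvPolynomial.totalDegree_aeval_le {σ τ R : Type*} [CommSemiring R]
    (f : σ → MvPolynomial τ R) (hf : ∀ i, (f i).totalDegree ≤ 1) (p : MvPolynomial σ R) :
    (MvPolynomial.aeval f p).totalDegree ≤ p.totalDegree := by
  rw [MvPolynomial.aeval_def, MvPolynomial.eval₂_eq]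
  refine MvPolynomial.totalDegree_finsetSum_le fun d hd => ?_
  refine (MvPolynomial.totalDegree_mul _ _).trans ?_
  rw [MvPolynomial.algebraMap_eq, MvPolynomial.totalDegree_C, zero_add]
  refine (MvPolynomial.totalDegree_finsetProd _ _).trans
    (le_trans ?_ (MvPolynomial.le_totalDegree hd))
  refine Finset.sum_le_sum fun i _ => (MvPolynomial.totalDegree_pow _ _).trans ?_
  exact (Nat.mul_le_mul_left _ (hf i)).trans (mul_one _).le

theorem exists_polyFun_eq_affineMap (f : Plane →ᵃ[ℝ] ℝ) :
    ∃ p : MvPolynomial (Fin 2) ℝ, p.totalDegree ≤ 1 ∧ ∀ x, polyFun p x = f x := by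
  refine ⟨MvPolynomial.C (f 0) + ∑ i : Fin 2,
    MvPolynomial.C (f.linear (EuclideanSpace.single i 1)) * MvPolynomial.X i, ?_, fun x => ?_⟩
  · refine (MvPolynomial.totalDegree_add _ _).trans (max_le (by simp) ?_)
    refine MvPolynomial.totalDegree_finsetSum_le fun i _ => ?_
    refine (MvPolynomial.totalDegree_mul _ _).trans ?_
    simp
  · have h1 : f x = f.linear x + f 0 := by
      have := f.map_vadd 0 x
      simpa using this
    have h2 := Plane.map_eq_sum f.linear.toContinuousLinearMap x
    simp only [LinearMap.coe_toContinuousLinearMap'] at h2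
    rw [h1, h2]
    simp [polyFun, Fin.sum_univ_two]
    ring

/-- The node with barycentric coordinates `α / k`. -/
noncomputable def lagrangeNode (k : ℕ) (T : PlaneTriangle) (α : Fin 3 → ℕ) : Plane :=
  ∑ j, ((α j : ℝ) / k) • T j

theorem AffineBasis.coord_sum_smul (b : AffineBasis (Fin 3) ℝ Plane) {w : Fin 3 → ℝ}
    (hw : ∑ j, w j = 1) (i : Fin 3) : b.coord i (∑ j, w j • b j) = w i := by
  rw [← Finset.affineCombination_eq_linear_combination _ _ _ hw]
  exact b.coord_apply_combination_of_mem (Finset.mem_univ i) hw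

theorem AffineBasis.coord_lagrangeNode (b : AffineBasis (Fin 3) ℝ Plane) {k : ℕ} (hk : 1 ≤ k)
    {α : Fin 3 → ℕ} (hα : ∑ j, α j = k) (i : Fin 3) :
    b.coord i (lagrangeNode k b α) = (α i : ℝ) / k := by
  refine b.coord_sum_smul ?_ i
  rw [← Finset.sum_div, ← Nat.cast_sum, hα, div_self (by positivity)]

/-- With barycentric coordinates $\lambda_j$, the basis function is
$\prod_j\prod_{s<\alpha_j}(k\lambda_j-s)/(\alpha_j-s)$. At the node `β` one has
$k\lambda_j=\beta_j$; if `β ≠ α` have the same sum, some $\beta_j<\alpha_j$, and the factor with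
$s=\beta_j$ vanishes. -/
theorem AffineBasis.exists_lagrange_basis (b : AffineBasis (Fin 3) ℝ Plane) {k : ℕ} (hk : 1 ≤ k) :
    ∃ L : (Fin 3 → ℕ) → MvPolynomial (Fin 2) ℝ,
      ∀ α : Fin 3 → ℕ, ∑ j, α j = k → (L α).totalDegree ≤ k ∧
        ∀ β : Fin 3 → ℕ, ∑ j, β j = k →
          polyFun (L α) (lagrangeNode k b β) = if α = β then 1 else 0 := by
  choose l hl1 hl using fun j => exists_polyFun_eq_affineMap (b.coord j)
  refine ⟨fun α => ∏ j, ∏ s ∈ Finset.range (α j), MvPolynomial.C (1 / ((α j : ℝ) - s)) *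
    (MvPolynomial.C (k : ℝ) * l j - MvPolynomial.C (s : ℝ)), fun α hα => ⟨?_, fun β hβ => ?_⟩⟩
  · refine (MvPolynomial.totalDegree_finsetProd _ _).trans ?_
    rw [← hα]
    refine Finset.sum_le_sum fun j _ => (MvPolynomial.totalDegree_finsetProd _ _).trans ?_
    refine (Finset.sum_le_card_nsmul _ _ 1 fun s _ => ?_).trans (by simp)
    refine (MvPolynomial.totalDegree_mul _ _).trans ?_
    rw [MvPolynomial.totalDegree_C, zero_add]
    refine (MvPolynomial.totalDegree_sub _ _).trans
      (max_le ?_ (by rw [MvPolynomial.totalDegree_C]; exact zero_le_one))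
    refine (MvPolynomial.totalDegree_mul _ _).trans ?_
    rw [MvPolynomial.totalDegree_C, zero_add]
    exact hl1 j
  · have hev : ∀ j, MvPolynomial.eval (fun i => lagrangeNode k b β i) (l j) = (β j : ℝ) / k :=
      fun j => (hl j _).trans (b.coord_lagrangeNode hk hβ j)
    have hk0 : (k : ℝ) ≠ 0 := by positivity
    simp only [polyFun, map_prod, map_mul, map_sub, MvPolynomial.eval_C, hev,
      mul_div_cancel₀ _ hk0]
    split_ifs with h
    · subst h
      refine Finset.prod_eq_one fun j _ => Finset.prod_eq_one fun s hs => ?_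
      have : (s : ℝ) < α j := by exact_mod_cast Finset.mem_range.1 hs
      rw [one_div, inv_mul_cancel₀ (by linarith)]
    · obtain ⟨j, hj⟩ : ∃ j, β j < α j := by
        by_contra! hle
        refine h (funext fun j => ?_)
        exact (Finset.sum_eq_sum_iff_of_le (fun j _ => hle j)).1 (hα.trans hβ.symm) j
          (Finset.mem_univ j)
      refine Finset.prod_eq_zero (Finset.mem_univ j)
        (Finset.prod_eq_zero (Finset.mem_range.2 hj) ?_)
      simp

/-- The index set of the Lagrange nodes. -/
def nodeIndices (k : ℕ) : Finset (Fin 3 → ℕ) := Finset.piAntidiag Finset.univ k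

theorem mem_nodeIndices {k : ℕ} {α : Fin 3 → ℕ} : α ∈ nodeIndices k ↔ ∑ j, α j = k := by
  simp [nodeIndices]

/-- The monomial $x^cy^d$ with $c+d\le k$ is sent to the index $(c,d,k-c-d)$. Only this inequality
is needed: the converse follows from surjectivity of evaluation at the nodes. -/
theorem finrank_restrictTotalDegree_le (k : ℕ) :
    Module.finrank ℝ (MvPolynomial.restrictTotalDegree (Fin 2) ℝ k) ≤ (nodeIndices k).card := by
  have hs : ∀ n : Fin 2 →₀ ℕ, (n.sum fun _ e => e) = n 0 + n 1 := fun n => by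
    rw [Finsupp.sum_fintype _ _ (fun _ => rfl), Fin.sum_univ_two]
  rw [MvPolynomial.restrictTotalDegree, Module.finrank_eq_nat_card_basis
    (MvPolynomial.basisRestrictSupport ℝ _), ← Nat.card_eq_finsetCard]
  refine Nat.card_le_card_of_injective
    (fun n => ⟨![n.1 0, n.1 1, k - (n.1 0 + n.1 1)], mem_nodeIndices.2 ?_⟩) fun n n' h => ?_
  · have : (n.1.sum fun _ e => e) ≤ k := n.2
    rw [hs] at this
    simp only [Fin.sum_univ_three, Matrix.cons_val]
    omega
  · have h' := congrArg Subtype.val h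
    refine Subtype.ext (Finsupp.ext fun i => ?_)
    fin_cases i
    · exact congrFun h' 0
    · exact congrFun h' 1

/-- Every polynomial of degree at most `k` is determined by its values at the Lagrange nodes. -/
theorem AffineBasis.exists_interpolation (b : AffineBasis (Fin 3) ℝ Plane) {k : ℕ} (hk : 1 ≤ k) :
    ∃ L : (Fin 3 → ℕ) → MvPolynomial (Fin 2) ℝ, ∀ p : MvPolynomial (Fin 2) ℝ, p.totalDegree ≤ k →
      ∀ x, polyFun p x =
        ∑ α ∈ nodeIndices k, polyFun p (lagrangeNode k b α) * polyFun (L α) x := by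
  obtain ⟨L, hL⟩ := b.exists_lagrange_basis hk
  refine ⟨L, fun p hp x => ?_⟩
  let V := MvPolynomial.restrictTotalDegree (Fin 2) ℝ k
  let E : V →ₗ[ℝ] (nodeIndices k → ℝ) :=
    { toFun := fun q α => polyFun q.1 (lagrangeNode k b α)
      map_add' := fun q r => by ext α; simp [polyFun]
      map_smul' := fun c q => by ext α; simp [polyFun] }
  have hLV : ∀ α : nodeIndices k, L α ∈ V := fun α =>
    (MvPolynomial.mem_restrictTotalDegree (Fin 2) k _).2 (hL α (mem_nodeIndices.1 α.2)).1
  let S : (nodeIndices k → ℝ) → V := fun c => ∑ α, c α • ⟨L α, hLV α⟩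
  have hES : ∀ c, E (S c) = c := fun c => by
    ext β
    have hα : ∀ α : nodeIndices k, E ⟨L α, hLV α⟩ β = if α = β then 1 else 0 := fun α => by
      have := (hL α (mem_nodeIndices.1 α.2)).2 β (mem_nodeIndices.1 β.2)
      simp only [E, LinearMap.coe_mk, AddHom.coe_mk, this, Subtype.ext_iff]
    simp only [S, map_sum, map_smul, Finset.sum_apply, Pi.smul_apply, hα, smul_eq_mul]
    simp
  have hsurj : Function.Surjective E := fun c => ⟨S c, hES c⟩
  -- Evaluation is onto by the nodal basis; equality of dimensions makes it injective, so the right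
  -- inverse `S` is also a left inverse.
  have hrank : Module.finrank ℝ V = Module.finrank ℝ (nodeIndices k → ℝ) := by
    refine le_antisymm ?_ (LinearMap.finrank_le_finrank_of_surjective hsurj)
    simpa using finrank_restrictTotalDegree_le k
  have hinj := (LinearMap.injective_iff_surjective_of_finrank_eq_finrank hrank).2 hsurj
  let q : V := ⟨p, (MvPolynomial.mem_restrictTotalDegree (Fin 2) k _).2 hp⟩
  have hq : S (E q) = q := hinj (hES _)
  have hq' : p = ∑ α : nodeIndices k, E q α • L α := by
    have := congrArg Subtype.val hq
    simpa [S, q] using this.symm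
  have hq'' : polyFun p x = ∑ α : nodeIndices k, E q α * polyFun (L α) x := by
    conv_lhs => rw [hq']
    simp [polyFun, MvPolynomial.smul_eval]
  rw [hq'']
  exact Finset.sum_coe_sort (nodeIndices k)
    fun α => polyFun p (lagrangeNode k b α) * polyFun (L α) x

/-- The derivatives of a polynomial on a scaled triangle are bounded by its values at the nodes. -/
theorem AffineBasis.exists_partialDeriv_le (b : AffineBasis (Fin 3) ℝ Plane) {k : ℕ} (hk : 1 ≤ k)
    (q : Plane) : ∃ C : ℝ, 0 < C ∧ ∀ r : ℝ, 0 < r → ∀ p : MvPolynomial (Fin 2) ℝ,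
      p.totalDegree ≤ k → ∀ M : ℝ,
      (∀ α : Fin 3 → ℕ, ∑ j, α j = k →
        |polyFun p (AffineMap.homothety q r (lagrangeNode k b α))| ≤ M) →
      ∀ x ∈ convexHull ℝ (range b), ∀ j,
        |partialDeriv j (polyFun p) (AffineMap.homothety q r x)| ≤ C * M / r := by
  obtain ⟨L, hL⟩ := b.exists_interpolation hk
  have hcpt : IsCompact (convexHull ℝ (range b)) := (finite_range b).isCompact_convexHull (𝕜 := ℝ)
  have hbd : ∀ (α : Fin 3 → ℕ) (j : Fin 2), ∃ c : ℝ, ∀ x ∈ convexHull ℝ (range b),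
      ‖partialDeriv j (polyFun (L α)) x‖ ≤ c := fun α j =>
    hcpt.exists_bound_of_continuousOn ((contDiff_polyFun _).partialDeriv j).continuous.continuousOn
  choose c hc using hbd
  refine ⟨1 + ∑ α ∈ nodeIndices k, ∑ j, |c α j|, by positivity, ?_⟩
  intro r hr p hp M hM x hx j
  have hhom : ∀ y, AffineMap.homothety q r y = q + r • (y - q) := fun y => by
    rw [AffineMap.homothety_apply]; simp [add_comm]
  -- `p'` is `p` pulled back to the unscaled triangle. The degree does not grow since the
  -- substitution is affine, and the chain rule produces the factor `1 / r`.
  set p' := MvPolynomial.aeval (fun i => MvPolynomial.C (q i) +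
    MvPolynomial.C r * (MvPolynomial.X i - MvPolynomial.C (q i))) p with hp'
  have hev : ∀ y, polyFun p' y = polyFun p (AffineMap.homothety q r y) := fun y => by
    refine polyFun_aeval _ _ _ _ fun i => ?_
    rw [hhom]
    simp [polyFun]
  have hdeg : p'.totalDegree ≤ k := by
    refine (MvPolynomial.totalDegree_aeval_le _ (fun i => ?_) p).trans hp
    refine (MvPolynomial.totalDegree_add _ _).trans (max_le (by simp) ?_)
    refine (MvPolynomial.totalDegree_mul _ _).trans ?_
    rw [MvPolynomial.totalDegree_C, zero_add]
    exact (MvPolynomial.totalDegree_sub _ _).trans (max_le (by simp) (by simp))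
  have e₁ : partialDeriv j (polyFun p') x =
      r * partialDeriv j (polyFun p) (AffineMap.homothety q r x) := by
    have h1 : HasFDerivAt (fun y => AffineMap.homothety q r y)
        (r • ContinuousLinearMap.id ℝ Plane) x := by
      simp only [hhom]
      exact (((hasFDerivAt_id x).sub_const q).const_smul r).const_add q
    have h2 := ((contDiff_polyFun p).differentiable (by simp)
      (AffineMap.homothety q r x)).hasFDerivAt
    have h3 := (h2.comp x h1).fderiv
    rw [show polyFun p' = polyFun p ∘ fun y => AffineMap.homothety q r y from funext hev]
    unfold partialDeriv
    rw [h3]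
    simp
  have e₂ : partialDeriv j (polyFun p') x = ∑ α ∈ nodeIndices k,
      polyFun p' (lagrangeNode k b α) * partialDeriv j (polyFun (L α)) x := by
    have h1 : HasFDerivAt (fun y => ∑ α ∈ nodeIndices k,
        polyFun p' (lagrangeNode k b α) * polyFun (L α) y)
        (∑ α ∈ nodeIndices k, polyFun p' (lagrangeNode k b α) • fderiv ℝ (polyFun (L α)) x) x :=
      HasFDerivAt.fun_sum fun α _ =>
        ((contDiff_polyFun _).differentiable (by simp) x).hasFDerivAt.const_mul _
    rw [← funext (hL p' hdeg)] at h1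
    unfold partialDeriv
    rw [h1.fderiv]
    simp
  -- The set of nodes is not empty: it contains a vertex.
  have hM0 : 0 ≤ M := (abs_nonneg _).trans (hM (Pi.single 0 k) (by simp))
  have e₃ : |partialDeriv j (polyFun p') x| ≤ (1 + ∑ α ∈ nodeIndices k, ∑ j, |c α j|) * M := by
    rw [e₂, add_mul, Finset.sum_mul]
    refine (Finset.abs_sum_le_sum_abs _ _).trans (le_trans ?_ (le_add_of_nonneg_left (by linarith)))
    refine Finset.sum_le_sum fun α hα => ?_
    rw [abs_mul, mul_comm, hev]
    refine mul_le_mul ?_ (hM α (mem_nodeIndices.1 hα)) (abs_nonneg _)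
      (Finset.sum_nonneg fun _ _ => abs_nonneg _)
    refine (hc α j x hx).trans ((le_abs_self _).trans ?_)
    exact Finset.single_le_sum (f := fun j => |c α j|) (fun _ _ => abs_nonneg _)
      (Finset.mem_univ j)
  rw [e₁, abs_mul, abs_of_pos hr] at e₃
  rw [le_div_iff₀ hr, mul_comm]
  exact e₃

/-! ### Innermost triangles of graded meshes -/

theorem AffineIndependent.exists_affineBasis {T : PlaneTriangle} (hT : AffineIndependent ℝ T) :
    ∃ b : AffineBasis (Fin 3) ℝ Plane, ⇑b = T :=
  ⟨⟨T, hT, (hT.affineSpan_eq_top_iff_card_eq_finrank_add_one).2 (by simp)⟩, rfl⟩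

section GradedMesh

variable {N : ℕ} {Q : Fin N → Plane} {κ : Fin N → ℝ}

/-- In all three cases of the grading the new node is strictly between the endpoints, and this is
all that is needed away from the vertices of the domain. -/
theorem exists_gradedNode_eq_lineMap (hQ : Function.Injective Q) (hκ : ∀ j, κ j ∈ Ioo (0 : ℝ) 1)
    (A B : Plane) : ∃ c ∈ Ioo (0 : ℝ) 1, gradedNode Q κ A B = AffineMap.lineMap A B c := by
  unfold gradedNode
  split_ifs with h₁ h₂
  · obtain ⟨j, rfl⟩ := h₁
    exact ⟨κ j, hκ j, by rw [hQ.extend_apply]⟩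
  · obtain ⟨j, rfl⟩ := h₂
    refine ⟨1 - κ j, ⟨by linarith [(hκ j).2], by linarith [(hκ j).1]⟩, ?_⟩
    rw [hQ.extend_apply, AffineMap.lineMap_apply_one_sub]
  · exact ⟨1 / 2, by norm_num, by rw [midpoint]; norm_num⟩

theorem gradedNode_vertex (hQ : Function.Injective Q) (i : Fin N) (B : Plane) :
    gradedNode Q κ (Q i) B = AffineMap.homothety (Q i) (κ i) B := by
  rw [gradedNode, if_pos (mem_range_self i), hQ.extend_apply, AffineMap.homothety_eq_lineMap]

theorem gradedNode_lt_one (hQ : Function.Injective Q) (hκ : ∀ j, κ j ∈ Ioo (0 : ℝ) 1)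
    {f : Plane →ᵃ[ℝ] ℝ} {A B : Plane} (hA : f A ≤ 1) (hB : f B ≤ 1) (hAB : f A < 1 ∨ f B < 1) :
    f (gradedNode Q κ A B) < 1 := by
  obtain ⟨c, ⟨hc0, hc1⟩, h⟩ := exists_gradedNode_eq_lineMap hQ hκ A B
  rw [h, AffineMap.apply_lineMap, AffineMap.lineMap_apply_module, smul_eq_mul, smul_eq_mul]
  rcases hAB with hA' | hB' <;> nlinarith

theorem convexHull_lt_one {f : Plane →ᵃ[ℝ] ℝ} {s : Set Plane} (h : ∀ x ∈ s, f x < 1) {x : Plane}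
    (hx : x ∈ convexHull ℝ s) : f x < 1 :=
  convexHull_min (t := f ⁻¹' Iio 1) h ((convex_Iio 1).affine_preimage f) hx

theorem gradedNode_mem_closed (hQ : Function.Injective Q) (hκ : ∀ j, κ j ∈ Ioo (0 : ℝ) 1)
    (S : PlaneTriangle) (p l : Fin 3) : gradedNode Q κ (S p) (S l) ∈ S.closed := by
  obtain ⟨c, hc, h⟩ := exists_gradedNode_eq_lineMap hQ hκ (S p) (S l)
  rw [h]
  exact (convex_convexHull ℝ _).lineMap_mem (subset_convexHull ℝ _ (mem_range_self p))
    (subset_convexHull ℝ _ (mem_range_self l)) ⟨hc.1.le, hc.2.le⟩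

/-- A triangle of the graded mesh touching a vertex of the domain is a scaled copy of its
ancestor. -/
theorem gradedMesh_eq_homothety (hQ : Function.Injective Q) (hκ : ∀ j, κ j ∈ Ioo (0 : ℝ) 1)
    {𝒯₀ : Set PlaneTriangle} (hnd : ∀ T ∈ 𝒯₀, AffineIndependent ℝ T) (i : Fin N) (n : ℕ) :
    ∀ T ∈ gradedMesh Q κ 𝒯₀ n, ∃ T' ∈ 𝒯₀, T.closed ⊆ T'.closed ∧
      ∀ j, T' j = Q i → Q i ∈ T.closed →
        T = fun l => AffineMap.homothety (Q i) (κ i ^ n) (T' l) := by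
  induction n with
  | zero => exact fun T hT => ⟨T, hT, subset_rfl, fun j _ _ => by simp⟩
  | succ n ih =>
    intro T hT
    simp only [gradedMesh, gradedRefine, mem_iUnion, exists_prop] at hT
    obtain ⟨S, hS, hTS⟩ := hT
    obtain ⟨T', hT', hST', hhom⟩ := ih S hS
    have hsub : T.closed ⊆ S.closed := by
      refine convexHull_min ?_ (convex_convexHull ℝ _)
      rintro _ ⟨l, rfl⟩
      rcases hTS with rfl | ⟨p, rfl⟩
      · exact gradedNode_mem_closed hQ hκ S _ _
      · exact gradedNode_mem_closed hQ hκ S _ _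
    refine ⟨T', hT', hsub.trans hST', fun j hj hq => ?_⟩
    have hSe := hhom j hj (hsub hq)
    obtain ⟨b, hb⟩ := (hnd T' hT').exists_affineBasis
    have hr : 0 < κ i ^ n := pow_pos (hκ i).1 n
    have hSj : S j = Q i := by
      rw [hSe]
      change AffineMap.homothety (Q i) (κ i ^ n) (T' j) = Q i
      rw [hj, AffineMap.homothety_apply_same]
    -- The barycentric coordinate of the ancestor at its vertex `Q i` serves as a separating
    -- function: among the vertices of `S` it reaches 1 only at `Q i`.
    have hfj : b.coord j (Q i) = 1 := by rw [← hj, ← hb]; simp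
    have hfl : ∀ l, l ≠ j → b.coord j (S l) < 1 := by
      intro l hl
      have h0 : b.coord j (T' l) = 0 := by rw [← hb]; exact b.coord_apply_ne hl.symm
      rw [hSe]
      change b.coord j (AffineMap.homothety (Q i) (κ i ^ n) (T' l)) < 1
      rw [AffineMap.homothety_eq_lineMap, AffineMap.apply_lineMap, hfj, h0,
        AffineMap.lineMap_apply_module, smul_eq_mul, smul_eq_mul]
      linarith
    have hfle : ∀ l, b.coord j (S l) ≤ 1 := fun l => by
      by_cases hl : l = j
      · rw [hl, hSj, hfj]
      · exact (hfl l hl).le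
    -- In every other child all three vertices have coordinate less than 1, so the child cannot
    -- contain `Q i`.
    have hTe : T = cornerChild Q κ S j := by
      by_contra hne
      refine lt_irrefl (1 : ℝ) ?_
      conv_lhs => rw [← hfj]
      refine convexHull_lt_one ?_ hq
      rintro _ ⟨l, rfl⟩
      rcases hTS with rfl | ⟨p, rfl⟩
      · refine gradedNode_lt_one hQ hκ (hfle _) (hfle _) ?_
        -- The endpoints of an edge are distinct, hence at least one of them is not the vertex `j`.
        by_cases h1 : l + 1 = j
        · refine Or.inr (hfl _ fun h2 => ?_)
          have h3 : ∀ l : Fin 3, l + 2 ≠ l + 1 := by decide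
          exact h3 l (h2.trans h1.symm)
        · exact Or.inl (hfl _ h1)
      · have hp : p ≠ j := fun h => hne (by rw [h])
        exact gradedNode_lt_one hQ hκ (hfle _) (hfle _) (Or.inl (hfl p hp))
    rw [hTe]
    ext1 l
    rw [cornerChild, hSj, gradedNode_vertex hQ, hSe, pow_succ', AffineMap.homothety_mul_apply]

/-- An attached triangle is a scaled copy of a triangle of the initial mesh with the same
vertex. -/
theorem IsAttachedTriangle.exists_eq_homothety {Ω : Set Plane} (hQ : Function.Injective Q)
    (hκ : ∀ j, κ j ∈ Ioo (0 : ℝ) 1) {𝒯₀ : Set PlaneTriangle} (h𝒯 : IsTriangulation Ω 𝒯₀)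
    {T₀ : PlaneTriangle} (hT₀ : T₀ ∈ 𝒯₀) {i : Fin N} (hi : Q i ∈ range T₀) {n : ℕ}
    {T : PlaneTriangle} (hT : IsAttachedTriangle Q κ 𝒯₀ T₀ (Q i) n T) :
    ∃ T' ∈ 𝒯₀, T.closed ⊆ T'.closed ∧ ∃ j, T' j = Q i ∧
      T = fun l => AffineMap.homothety (Q i) (κ i ^ n) (T' l) := by
  obtain ⟨T', hT', hsub, hhom⟩ := gradedMesh_eq_homothety hQ hκ h𝒯.nondegenerate i n T hT.1
  have hqT : Q i ∈ T.closed := subset_convexHull ℝ _ hT.2.2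
  obtain ⟨p, hp⟩ := hi
  -- By conformity `Q i` lies in the hull of the common vertices of `T₀` and `T'`. Were it not a
  -- vertex of `T'`, its own barycentric coordinate in `T₀` would vanish at all of them.
  have hex : ∃ j, T' j = Q i := by
    by_contra! hne
    obtain ⟨b, hb⟩ := (h𝒯.nondegenerate T₀ hT₀).exists_affineBasis
    have hmem : Q i ∈ convexHull ℝ (range T₀ ∩ range T') := by
      rw [← h𝒯.conforming T₀ hT₀ T' hT']
      exact ⟨subset_convexHull ℝ _ ⟨p, hp⟩, hsub hqT⟩
    have hfp : b.coord p (Q i) = 1 := by rw [← hp, ← hb]; simp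
    refine lt_irrefl (1 : ℝ) ?_
    conv_lhs => rw [← hfp]
    refine convexHull_lt_one ?_ hmem
    rintro _ ⟨⟨l, rfl⟩, m, hm⟩
    have hlp : p ≠ l := by
      rintro rfl
      exact hne m (hm.trans hp)
    rw [← hb, b.coord_apply_ne hlp]
    exact one_pos
  obtain ⟨j, hj⟩ := hex
  exact ⟨T', hT', hsub, j, hj, hhom j hj hqT⟩

end GradedMesh

/-! ### Weighted estimates on scaled triangles -/

/-- The functions `g ν` are the weak derivatives of order at most two of `v`, with weighted
`L²`-norm at most `R` for the weight of `𝒦_{a+1}` at the point `q`. -/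
def HasWeightedJet (G : Set Plane) (q : Plane) (a R : ℝ) (v : Plane → ℝ)
    (g : ℕ × ℕ → Plane → ℝ) : Prop :=
  ∀ ν : ℕ × ℕ, ν.1 + ν.2 ≤ 2 → HasWeakDeriv G ν v (g ν) ∧
    ∫⁻ x in G, ‖dist x q ^ (((ν.1 + ν.2 : ℕ) : ℝ) - (a + 1)) * g ν x‖ₑ ^ 2 ≤ ENNReal.ofReal (R ^ 2)

/-- An infimum over an empty family is `∞`, so a finite norm forces the weak derivatives to exist;
each term is then at most the whole sum. The condition `1 ≤ m` puts the orders up to two into that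
sum. -/
theorem exists_hasWeightedJet {G : Set Plane} (hG : IsOpen G) {q : Plane} {a : ℝ} {m : ℕ}
    (hm : 1 ≤ m) {v : Plane → ℝ}
    (hv : kondratievNorm (fun _ : Unit => q) (fun _ => a + 1) (m + 1) G v ≠ ⊤) :
    ∃ g, HasWeightedJet G q a
      (kondratievNorm (fun _ : Unit => q) (fun _ => a + 1) (m + 1) G v).toReal v g := by
  set S := kondratievNorm (fun _ : Unit => q) (fun _ => a + 1) (m + 1) G v with hS
  set X := ∑ l ∈ Finset.range (m + 1 + 1),
    weightedSqSum G (cornerWeight (fun _ : Unit => q) (fun _ => a + 1) l) l v with hX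
  have hSX : ENNReal.ofReal (S.toReal ^ 2) = X := by
    rw [ENNReal.ofReal_pow ENNReal.toReal_nonneg, ENNReal.ofReal_toReal hv, hS, kondratievNorm,
      ← ENNReal.rpow_natCast, ← ENNReal.rpow_mul]
    norm_num [hX]
  have hXt : X < ⊤ := by rw [← hSX]; exact ENNReal.ofReal_lt_top
  have hle : ∀ ν : ℕ × ℕ, ν.1 + ν.2 ≤ 2 →
      ⨅ (g : Plane → ℝ) (_ : HasWeakDeriv G ν v g),
        ∫⁻ x in G, ‖cornerWeight (fun _ : Unit => q) (fun _ => a + 1) (ν.1 + ν.2) x * g x‖ₑ ^ 2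
        ≤ X := by
    intro ν hν
    have h1 : ν.1 + ν.2 ∈ Finset.range (m + 1 + 1) := Finset.mem_range.2 (by omega)
    have h2 : ν ∈ Finset.HasAntidiagonal.antidiagonal (ν.1 + ν.2) :=
      Finset.HasAntidiagonal.mem_antidiagonal.2 rfl
    refine le_trans ?_ (Finset.single_le_sum (f := fun l => weightedSqSum G
      (cornerWeight (fun _ : Unit => q) (fun _ => a + 1) l) l v) (fun _ _ => zero_le) h1)
    exact Finset.single_le_sum (f := fun ν : ℕ × ℕ => ⨅ (g : Plane → ℝ) (_ : HasWeakDeriv G ν v g),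
      ∫⁻ x in G, ‖cornerWeight (fun _ : Unit => q) (fun _ => a + 1) _ x * g x‖ₑ ^ 2)
      (fun _ _ => zero_le) h2
  have hex : ∀ ν : ℕ × ℕ, ∃ g : Plane → ℝ, ν.1 + ν.2 ≤ 2 → HasWeakDeriv G ν v g := by
    intro ν
    by_contra! hne
    have hν := (hne 0).1
    have := (hle ν hν).trans_lt hXt
    simp [fun g => (hne g).2] at this
  choose g hg using hex
  refine ⟨g, fun ν hν => ⟨hg ν hν, ?_⟩⟩
  rw [hSX]
  refine le_trans (le_of_eq ?_) (hle ν hν)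
  rw [(hg ν hν).iInf_lintegral_eq hG]
  simp [cornerWeight]

/-- Cauchy–Schwarz: a bound of the `L¹`-norm by a weighted `L²`-norm. -/
theorem integral_abs_le_of_weighted {G P : Set Plane} (hP : MeasurableSet P) (hPG : P ⊆ G)
    (hPv : volume P ≠ ⊤) {w g : Plane → ℝ} {M R : ℝ} (hM : 0 ≤ M) (hR : 0 ≤ R)
    (hg : LocallyIntegrableOn g G)
    (hw : ∀ x ∈ P, 1 ≤ M * |w x|) (h : ∫⁻ x in G, ‖w x * g x‖ₑ ^ 2 ≤ ENNReal.ofReal (R ^ 2)) :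
    IntegrableOn g P ∧ ∫ x in P, |g x| ≤ M * √(volume.real P) * R := by
  have hmeas : AEStronglyMeasurable g (volume.restrict P) :=
    (hg.aestronglyMeasurable).mono_set hPG
  have h1 : ∫⁻ x in P, ‖g x‖ₑ ^ 2 ≤ ENNReal.ofReal ((M * R) ^ 2) := by
    calc ∫⁻ x in P, ‖g x‖ₑ ^ 2 ≤ ∫⁻ x in P, ENNReal.ofReal (M ^ 2) * ‖w x * g x‖ₑ ^ 2 := by
          refine setLIntegral_mono' hP fun x hx => ?_
          rw [ENNReal.ofReal_pow hM, ← mul_pow, enorm_mul, ← mul_assoc]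
          gcongr
          refine le_mul_of_one_le_left zero_le ?_
          rw [Real.enorm_eq_ofReal_abs, ← ENNReal.ofReal_mul hM]
          exact ENNReal.one_le_ofReal.2 (hw x hx)
      _ = ENNReal.ofReal (M ^ 2) * ∫⁻ x in P, ‖w x * g x‖ₑ ^ 2 :=
          lintegral_const_mul' _ _ ENNReal.ofReal_ne_top
      _ ≤ ENNReal.ofReal (M ^ 2) * ENNReal.ofReal (R ^ 2) := by
          gcongr
          exact (lintegral_mono_set hPG).trans h
      _ = ENNReal.ofReal ((M * R) ^ 2) := by
          rw [← ENNReal.ofReal_mul (by positivity), mul_pow]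
  have h2 : ∫⁻ x in P, ‖g x‖ₑ ≤ ENNReal.ofReal (M * √(volume.real P) * R) := by
    have hH := ENNReal.lintegral_mul_le_Lp_mul_Lq (volume.restrict P) Real.HolderConjugate.two_two
      hmeas.enorm (aemeasurable_const (b := (1 : ℝ≥0∞)))
    simp only [Pi.mul_apply, mul_one, lintegral_const,
      Measure.restrict_apply MeasurableSet.univ, univ_inter, ENNReal.rpow_two, one_pow,
      one_mul] at hH
    refine hH.trans ?_
    calc _ ≤ ENNReal.ofReal ((M * R) ^ 2) ^ (1 / 2 : ℝ) * volume P ^ (1 / 2 : ℝ) := by gcongr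
      _ = ENNReal.ofReal (M * √(volume.real P) * R) := by
        rw [← ENNReal.ofReal_toReal hPv, ENNReal.ofReal_rpow_of_nonneg (by positivity) (by positivity),
          ENNReal.ofReal_rpow_of_nonneg (by positivity) (by positivity),
          ← ENNReal.ofReal_mul (by positivity), ← Real.sqrt_eq_rpow, ← Real.sqrt_eq_rpow,
          Real.sqrt_sq (by positivity), measureReal_def]
        congr 1; ring
  refine ⟨⟨hmeas, h2.trans_lt ENNReal.ofReal_lt_top⟩, ?_⟩
  have h3 : ∫ x in P, |g x| = (∫⁻ x in P, ‖g x‖ₑ).toReal := integral_norm_eq_lintegral_enorm hmeas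
  rw [h3]
  exact ENNReal.toReal_le_of_le_ofReal (by positivity) h2

/-! ### Homotheties and scaled triangles -/

theorem Plane.homothety_apply (q : Plane) (r : ℝ) (x : Plane) :
    AffineMap.homothety q r x = q + r • (x - q) := by
  rw [AffineMap.homothety_apply]; simp [add_comm]

theorem Plane.dist_homothety {r : ℝ} (hr : 0 < r) (q x : Plane) :
    dist (AffineMap.homothety q r x) q = r * dist x q := by
  rw [Plane.homothety_apply, dist_eq_norm, dist_eq_norm, add_sub_cancel_left, norm_smul,
    Real.norm_of_nonneg hr.le]

theorem Plane.volume_image_homothety {r : ℝ} (hr : 0 < r) (q : Plane) (s : Set Plane) :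
    volume (AffineMap.homothety q r '' s) = ENNReal.ofReal (r ^ 2) * volume s := by
  rw [Measure.addHaar_image_homothety]
  simp [abs_of_pos hr]

/-- The triangle scaled by the factor `r` towards the point `q`. -/
noncomputable def scaledTriangle (q : Plane) (r : ℝ) (T : PlaneTriangle) : PlaneTriangle :=
  fun l => AffineMap.homothety q r (T l)

theorem closed_scaledTriangle (q : Plane) (r : ℝ) (T : PlaneTriangle) :
    (scaledTriangle q r T).closed = AffineMap.homothety q r '' T.closed := by
  rw [PlaneTriangle.closed, PlaneTriangle.closed, AffineMap.image_convexHull, ← range_comp]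
  rfl

theorem lagrangeNode_scaledTriangle (q : Plane) (r : ℝ) (T : PlaneTriangle) {k : ℕ} (hk : 1 ≤ k)
    {α : Fin 3 → ℕ} (hα : ∑ j, α j = k) :
    lagrangeNode k (scaledTriangle q r T) α = AffineMap.homothety q r (lagrangeNode k T α) := by
  have hsum : ∑ j, (α j : ℝ) / k = 1 := by
    rw [← Finset.sum_div, ← Nat.cast_sum, hα, div_self (by positivity)]
  have hq : q = ∑ j, ((α j : ℝ) / k) • q := by rw [← Finset.sum_smul, hsum, one_smul]
  simp only [lagrangeNode, scaledTriangle, Plane.homothety_apply, smul_add, smul_sub,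
    Finset.sum_add_distrib, Finset.sum_sub_distrib, Finset.smul_sum]
  rw [← hq]
  simp only [smul_comm r, ← Finset.sum_smul, hsum, one_smul]

theorem isOpen_image_homothety {r : ℝ} (hr : 0 < r) (q : Plane) {s : Set Plane} (hs : IsOpen s) :
    IsOpen (AffineMap.homothety q r '' s) :=
  AffineMap.homothety_isOpenMap q r hr.ne' s hs

theorem isOpen_opened (T : PlaneTriangle) : IsOpen T.opened := isOpen_interior

theorem opened_subset_closed (T : PlaneTriangle) : T.opened ⊆ T.closed := interior_subset

theorem image_opened_subset_scaledTriangle {r : ℝ} (hr : 0 < r) (q : Plane) (T : PlaneTriangle) :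
    AffineMap.homothety q r '' T.opened ⊆ (scaledTriangle q r T).opened := by
  refine interior_maximal ?_ (isOpen_image_homothety hr q (isOpen_opened T))
  rw [closed_scaledTriangle]
  exact image_mono (opened_subset_closed T)

/-! ### Barycentric coordinates as oblique coordinates -/

/-- The linear part of a barycentric coordinate. -/
noncomputable def AffineBasis.coordDir (b : AffineBasis (Fin 3) ℝ Plane) (i : Fin 3) :
    Plane →L[ℝ] ℝ :=
  (b.coord i).linear.toContinuousLinearMap

theorem AffineBasis.coordDir_sub (b : AffineBasis (Fin 3) ℝ Plane) (i : Fin 3) (x y : Plane) :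
    b.coordDir i (x - y) = b.coord i x - b.coord i y :=
  (b.coord i).linearMap_vsub x y

theorem Fin.sum_univ_of_distinct {M : Type*} [AddCommMonoid M] (f : Fin 3 → M) {p j l : Fin 3}
    (hpj : p ≠ j) (hlj : l ≠ j) (hlp : l ≠ p) : ∑ i, f i = f p + f l + f j := by
  have h : (Finset.univ : Finset (Fin 3)) = {p, l, j} := by
    revert p j l; decide
  rw [h, Finset.sum_insert (by simp [hpj, hlp.symm]), Finset.sum_insert (by simp [hlj]),
    Finset.sum_singleton, add_assoc]

/-- The frame consists of the two edges leaving the vertex `b j`, scaled by `s`; the increments of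
the coordinates `p` and `l` along them are 0 or `s`. The parallelograms it spans will be placed at
the nodes. -/
theorem AffineBasis.isDualFrame (b : AffineBasis (Fin 3) ℝ Plane) {p j l : Fin 3}
    (hpj : p ≠ j) (hlj : l ≠ j) (hlp : l ≠ p) {s : ℝ} (hs : s ≠ 0) :
    IsDualFrame (s • (b p - b j)) (s • (b l - b j)) (s⁻¹ • b.coordDir p) (s⁻¹ • b.coordDir l) where
  apply₁₁ := by simp [b.coordDir_sub, b.coord_apply_ne hpj, hs]
  apply₁₂ := by simp [b.coordDir_sub, b.coord_apply_ne hpj, b.coord_apply_ne hlp.symm]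
  apply₂₁ := by simp [b.coordDir_sub, b.coord_apply_ne hlj, b.coord_apply_ne hlp]
  apply₂₂ := by simp [b.coordDir_sub, b.coord_apply_ne hlj, hs]
  reconstruct := fun x => by
    have h1 := b.linear_combination_coord_eq_self x
    have h2 := b.linear_combination_coord_eq_self 0
    have h3 := b.sum_coord_apply_eq_one x
    have h4 := b.sum_coord_apply_eq_one 0
    rw [Fin.sum_univ_of_distinct _ hpj hlj hlp] at h1 h2 h3 h4
    have h5 : ∀ i, b.coordDir i x = b.coord i x - b.coord i 0 := fun i => by
      rw [← b.coordDir_sub, sub_zero]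
    simp only [smul_apply, h5, smul_eq_mul, smul_smul]
    rw [mul_right_comm, inv_mul_cancel₀ hs, mul_right_comm, inv_mul_cancel₀ hs, one_mul, one_mul]
    have h6 : b.coord j x - b.coord j 0 =
        -(b.coord p x - b.coord p 0) - (b.coord l x - b.coord l 0) := by linarith
    have h7 : x = (b.coord p x - b.coord p 0) • b p + (b.coord l x - b.coord l 0) • b l +
        (b.coord j x - b.coord j 0) • b j := by
      conv_lhs => rw [← sub_zero x, ← h1, ← h2]
      module
    conv_rhs => rw [h7, h6]
    module

/-! ### Nodal values and the interpolation error -/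

/-- A function continuous at the vertex `q` of a triangle vanishes at `q` if it has a finite
weighted norm. -/
theorem eq_zero_of_weighted {b : AffineBasis (Fin 3) ℝ Plane} {p : Fin 3} {a R r : ℝ} (ha : 0 < a)
    (hr : 0 < r) {v u : Plane → ℝ} {g : ℕ × ℕ → Plane → ℝ}
    (hg : HasWeightedJet (scaledTriangle (b p) r b).opened (b p) a R v g)
    (hu : ContinuousOn u (scaledTriangle (b p) r b).closed)
    (huv : u =ᵐ[volume.restrict (scaledTriangle (b p) r b).opened] v) : u (b p) = 0 := by
  set q := b p with hq
  set T := scaledTriangle q r b with hT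
  have hGm : MeasurableSet T.opened := (isOpen_opened T).measurableSet
  by_contra hne
  have hqT : q ∈ T.closed := by
    refine subset_convexHull ℝ _ ⟨p, ?_⟩
    change AffineMap.homothety q r (b p) = q
    rw [← hq, AffineMap.homothety_apply_same]
  have hconv : Convex ℝ T.closed := convex_convexHull ℝ _
  have hbdd : Bornology.IsBounded T.closed :=
    ((finite_range T).isCompact_convexHull (𝕜 := ℝ)).isBounded
  obtain ⟨D, hD0, hD⟩ := hbdd.subset_closedBall_lt 0 q
  have hGne : T.opened.Nonempty := by
    obtain ⟨y, hy⟩ : (PlaneTriangle.opened b).Nonempty := by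
      rw [PlaneTriangle.opened, PlaneTriangle.closed,
        interior_convexHull_nonempty_iff_affineSpan_eq_top, b.tot]
    exact ⟨_, image_opened_subset_scaledTriangle hr q b ⟨y, hy, rfl⟩⟩
  have hV0 : 0 < volume T.opened := (isOpen_opened T).measure_pos _ hGne
  have hVt : volume T.opened ≠ ⊤ :=
    ((hbdd.subset (opened_subset_closed T)).measure_lt_top).ne
  obtain ⟨δ, hδ, hδu⟩ := Metric.continuousWithinAt_iff.1 (hu q hqT) (|u q| / 2) (by positivity)
  obtain ⟨hw, hI⟩ := hg (0, 0) (by simp)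
  have hvv : HasWeakDeriv T.opened (0, 0) v v :=
    ⟨hw.1, hw.1, fun φ _ _ _ => by simp [multiDeriv_zero]⟩
  have hgu : ∀ᵐ x ∂(volume.restrict T.opened), g (0, 0) x = u x := by
    filter_upwards [hw.ae_eq (isOpen_opened T) hvv, huv] with x h1 h2
    rw [h1, h2]
  -- The lower bound for the weighted integral at scale 1, with `|u|` replaced by `|u q| / 2`.
  set c : ℝ := (D ^ (-(a + 1)) * (|u q| / 2)) ^ 2 * volume.real T.opened with hc
  have hc0 : 0 < c := by
    have : 0 < volume.real T.opened := ENNReal.toReal_pos hV0.ne' hVt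
    positivity
  -- on the scaled triangle with factor `s` the weight is large
  have key : ∀ s : ℝ, 0 < s → s ≤ 1 → s * D < δ → c * s ^ (-(2 * a)) ≤ R ^ 2 := by
    intro s hs hs1 hsD
    set Gs := AffineMap.homothety q s '' T.opened with hGs
    have hGsT : Gs ⊆ T.opened := by
      refine interior_maximal ?_ (isOpen_image_homothety hs q (isOpen_opened T))
      rintro _ ⟨x, hx, rfl⟩
      rw [AffineMap.homothety_eq_lineMap]
      exact hconv.lineMap_mem hqT (opened_subset_closed T hx) ⟨hs.le, hs1⟩
    have hGsm : MeasurableSet Gs := (isOpen_image_homothety hs q (isOpen_opened T)).measurableSet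
    set E : ℝ := (s * D) ^ (-(a + 1)) * (|u q| / 2) with hE
    have hE0 : 0 ≤ E := by positivity
    -- At `q` itself the negative power takes the default value 0 and the lower bound would fail; a
    -- single point is negligible.
    have hne : ∀ᵐ x ∂(volume.restrict Gs), x ≠ q :=
      ae_restrict_of_ae (compl_mem_ae_iff.2 (measure_singleton q))
    have h1 : ENNReal.ofReal (E ^ 2) * volume Gs ≤ ENNReal.ofReal (R ^ 2) := by
      refine le_trans ?_ ((lintegral_mono_set hGsT).trans hI)
      rw [← setLIntegral_const]
      refine lintegral_mono_ae ?_
      filter_upwards [hne, ae_restrict_of_ae_restrict_of_subset hGsT hgu, ae_restrict_mem hGsm]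
        with x hxq hxu hx
      rw [hxu, ENNReal.ofReal_pow hE0]
      gcongr
      rw [Real.enorm_eq_ofReal_abs]
      refine ENNReal.ofReal_le_ofReal ?_
      have hdpos : 0 < dist x q := dist_pos.2 hxq
      have hds : dist x q ≤ s * D := by
        obtain ⟨y, hy, rfl⟩ := hx
        rw [Plane.dist_homothety hs]
        exact mul_le_mul_of_nonneg_left (hD (opened_subset_closed T hy)) hs.le
      rw [abs_mul, abs_of_nonneg (Real.rpow_nonneg hdpos.le _)]
      simp only [add_zero, Nat.cast_zero, zero_sub]
      refine mul_le_mul (Real.rpow_le_rpow_of_nonpos hdpos hds (by linarith)) ?_ (by positivity)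
        (by positivity)
      have h2 := hδu (opened_subset_closed T (hGsT hx)) (hds.trans_lt hsD)
      rw [Real.dist_eq] at h2
      have h3 := abs_sub_abs_le_abs_sub (u q) (u x)
      rw [abs_sub_comm] at h3
      linarith
    rw [hGs, Plane.volume_image_homothety hs, ← ENNReal.ofReal_toReal hVt,
      ← ENNReal.ofReal_mul (by positivity), ← ENNReal.ofReal_mul (by positivity),
      ENNReal.ofReal_le_ofReal_iff (by positivity)] at h1
    refine le_trans (le_of_eq ?_) h1
    rw [hc, hE, Real.mul_rpow hs.le hD0.le, measureReal_def]
    -- The squared weight contributes $s^{-2(a+1)}$ and the area $s^2$.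
    have h2 : s ^ (-(2 * a)) = (s ^ (-(a + 1))) ^ 2 * s ^ 2 := by
      rw [← Real.rpow_natCast, ← Real.rpow_natCast, ← Real.rpow_mul hs.le, ← Real.rpow_add hs]
      congr 1; push_cast; ring
    rw [h2]; ring
  -- The inequality reads $c\le R^2s^{2a}$, whose right side tends to 0 with `s` because `a` is
  -- positive.
  have hlim : Filter.Tendsto (fun s : ℝ => R ^ 2 * s ^ (2 * a)) (nhdsWithin 0 (Ioi 0))
      (nhds (R ^ 2 * 0)) := by
    refine Filter.Tendsto.const_mul _ ?_
    have := (Real.continuousAt_rpow_const 0 (2 * a) (Or.inr (by positivity))).tendsto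
    rw [Real.zero_rpow (by positivity)] at this
    exact this.mono_left nhdsWithin_le_nhds
  rw [mul_zero] at hlim
  have hev : ∀ᶠ s : ℝ in nhdsWithin 0 (Ioi 0), s ≤ 1 ∧ s * D < δ := by
    have h1 : ∀ᶠ s : ℝ in nhds 0, s < 1 := Iio_mem_nhds one_pos
    have h2 : ∀ᶠ s : ℝ in nhds 0, s * D < δ := by
      have : Filter.Tendsto (fun s : ℝ => s * D) (nhds 0) (nhds (0 * D)) :=
        (continuous_id.mul continuous_const).tendsto 0
      rw [zero_mul] at this
      exact this.eventually (Iio_mem_nhds hδ)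
    exact nhdsWithin_le_nhds (h1.mono (fun s h => h.le) |>.and h2)
  obtain ⟨s, hs1, hs2, hs3⟩ := ((hlim.eventually (Iio_mem_nhds hc0)).and
    (hev.and self_mem_nhdsWithin)).exists
  have h := key s hs3 hs2.1 hs2.2
  have hs0 : 0 < s := hs3
  have hpos : 0 < s ^ (2 * a) := Real.rpow_pos_of_pos hs0 _
  rw [Real.rpow_neg hs0.le, ← div_eq_mul_inv, div_le_iff₀ hpos] at h
  have hs1' : R ^ 2 * s ^ (2 * a) < c := hs1
  linarith

/-- Scaling both the figure and its frame leaves the oblique coordinates unchanged, so the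
parallelograms at all scales are copies of a single one and the constants can be fixed on that one.
-/
theorem openParallelogram_scaled (l₁ l₂ : Plane →L[ℝ] ℝ) (q z : Plane) {ε r : ℝ} (hr : 0 < r) :
    openParallelogram ((ε * r)⁻¹ • l₁) ((ε * r)⁻¹ • l₂) (AffineMap.homothety q r z) =
      AffineMap.homothety q r '' openParallelogram (ε⁻¹ • l₁) (ε⁻¹ • l₂) z := by
  have h1 : ∀ (l : Plane →L[ℝ] ℝ) (y : Plane), ((ε * r)⁻¹ • l) (AffineMap.homothety q r y -
      AffineMap.homothety q r z) = (ε⁻¹ • l) (y - z) := fun l y => by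
    rw [Plane.homothety_apply, Plane.homothety_apply, add_sub_add_left_eq_sub, ← smul_sub,
      sub_sub_sub_cancel_right, map_smul, smul_apply, smul_apply, smul_eq_mul, smul_eq_mul,
      smul_eq_mul, mul_inv]
    field_simp
  ext x
  constructor
  · intro hx
    refine ⟨q + r⁻¹ • (x - q), ?_, ?_⟩
    · have h2 : AffineMap.homothety q r (q + r⁻¹ • (x - q)) = x := by
        rw [Plane.homothety_apply]; simp [smul_smul, hr.ne']
      rw [openParallelogram, mem_ofPred_eq, ← h1, ← h1, h2]
      exact hx
    · rw [Plane.homothety_apply]; simp [smul_smul, hr.ne']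
  · rintro ⟨y, hy, rfl⟩
    rw [openParallelogram, mem_ofPred_eq, h1, h1]
    exact hy

/-- The parallelogram at a node of the triangle, with sides pointing into the triangle, stays in
the triangle and away from the opposite side. -/
theorem AffineBasis.coord_of_mem_openParallelogram (b : AffineBasis (Fin 3) ℝ Plane)
    {p j l : Fin 3} (hpj : p ≠ j) (hlj : l ≠ j) (hlp : l ≠ p) {k : ℕ} (hk : 1 ≤ k)
    {α : Fin 3 → ℕ} (hα : ∑ j, α j = k) (hαj : 1 ≤ α j) {x : Plane}
    (hx : x ∈ openParallelogram ((1 / (4 * k : ℝ))⁻¹ • b.coordDir p)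
      ((1 / (4 * k : ℝ))⁻¹ • b.coordDir l) (lagrangeNode k b α)) :
    (∀ i, 0 ≤ b.coord i x) ∧ 1 / (2 * k : ℝ) ≤ b.coord j x := by
  have hk0 : (0 : ℝ) < k := by positivity
  obtain ⟨⟨h1, h2⟩, h3, h4⟩ := hx
  simp only [smul_apply, b.coordDir_sub, b.coord_lagrangeNode hk hα, smul_eq_mul, one_div,
    inv_inv] at h1 h2 h3 h4
  have hsum := b.sum_coord_apply_eq_one x
  rw [Fin.sum_univ_of_distinct _ hpj hlj hlp] at hsum
  have hsumα : (α p : ℝ) + α l + α j = k := by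
    rw [Fin.sum_univ_of_distinct _ hpj hlj hlp] at hα
    exact_mod_cast hα
  have hαj' : (1 : ℝ) ≤ α j := by exact_mod_cast hαj
  have hp0 : (0 : ℝ) ≤ α p := Nat.cast_nonneg _
  have hl0 : (0 : ℝ) ≤ α l := Nat.cast_nonneg _
  have e1 : 4 * k * (b.coord p x - α p / k) = 4 * (k * b.coord p x) - 4 * α p := by
    field_simp
  have e2 : 4 * k * (b.coord l x - α l / k) = 4 * (k * b.coord l x) - 4 * α l := by
    field_simp
  rw [e1] at h1 h2
  rw [e2] at h3 h4
  have hsumk : k * b.coord p x + k * b.coord l x + k * b.coord j x = k := by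
    rw [← mul_add, ← mul_add, hsum, mul_one]
  -- With sides `1 / (4 * k)`, the other two coordinates increase by less than `1 / (4 * k)` each,
  -- so this one falls by less than `1 / (2 * k)` from its value of at least `1 / k` at the node.
  have hj : 1 / (2 * k : ℝ) ≤ b.coord j x := by
    rw [div_le_iff₀ (by positivity)]
    nlinarith
  have hp' : 0 ≤ b.coord p x := nonneg_of_mul_nonneg_right (by linarith) hk0
  have hl' : 0 ≤ b.coord l x := nonneg_of_mul_nonneg_right (by linarith) hk0
  have hj' : 0 ≤ b.coord j x := le_trans (by positivity) hj
  refine ⟨fun i => ?_, hj⟩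
  have : i = p ∨ i = l ∨ i = j := by
    revert hpj hlj hlp; clear * -; revert i p j l; decide
  rcases this with rfl | rfl | rfl <;> assumption

/-- The coordinate `j` vanishes at `b p` and is Lipschitz, so a point where it is at least `1 / (2 *
k)` is at a definite distance from `b p`. -/
theorem AffineBasis.exists_dist_bounds (b : AffineBasis (Fin 3) ℝ Plane) {p j : Fin 3}
    (hpj : p ≠ j) {k : ℕ} (hk : 1 ≤ k) : ∃ c D : ℝ, 0 < c ∧ 0 < D ∧
      ∀ x ∈ convexHull ℝ (range b), dist x (b p) ≤ D ∧
        (1 / (2 * k : ℝ) ≤ b.coord j x → c ≤ dist x (b p)) := by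
  have hbdd : Bornology.IsBounded (convexHull ℝ (range b)) :=
    ((finite_range b).isCompact_convexHull (𝕜 := ℝ)).isBounded
  obtain ⟨D, hD0, hD⟩ := hbdd.subset_closedBall_lt 0 (b p)
  have hk0 : (0 : ℝ) < k := by positivity
  refine ⟨1 / (2 * k) / (‖b.coordDir j‖ + 1), D, by positivity, hD0,
    fun x hx => ⟨hD hx, fun hj => ?_⟩⟩
  rw [div_le_iff₀ (by positivity)]
  have h1 : b.coordDir j (x - b p) = b.coord j x := by
    rw [b.coordDir_sub, b.coord_apply_ne hpj.symm, sub_zero]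
  have h2 := (le_abs_self _).trans ((b.coordDir j).le_opNorm (x - b p))
  rw [h1, ← dist_eq_norm] at h2
  have h3 : 0 ≤ dist x (b p) := dist_nonneg
  nlinarith

/-- A continuous function with a finite weighted norm is bounded at the nodes of a scaled
triangle. -/
theorem AffineBasis.exists_node_bound (b : AffineBasis (Fin 3) ℝ Plane) {p j : Fin 3}
    (hpj : p ≠ j) {k : ℕ} (hk : 1 ≤ k) {α : Fin 3 → ℕ} (hα : ∑ j, α j = k) (hαj : 1 ≤ α j)
    (a : ℝ) : ∃ C : ℝ, 0 ≤ C ∧ ∀ r : ℝ, 0 < r → ∀ R : ℝ, 0 ≤ R →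
      ∀ (v u : Plane → ℝ) (g : ℕ × ℕ → Plane → ℝ),
      HasWeightedJet (scaledTriangle (b p) r b).opened (b p) a R v g →
      ContinuousOn u (scaledTriangle (b p) r b).closed →
      u =ᵐ[volume.restrict (scaledTriangle (b p) r b).opened] v →
      |u (lagrangeNode k (scaledTriangle (b p) r b) α)| ≤ C * r ^ a * R := by
  have hthird : ∀ p j : Fin 3, ∃ l : Fin 3, l ≠ j ∧ l ≠ p := by decide
  -- The frame starts at the vertex `j`, where the node has positive weight; moving along it lowers
  -- only the coordinate `j`, which leaves room inside the triangle.
  obtain ⟨l, hlj, hlp⟩ := hthird p j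
  obtain ⟨K, hK0, hK⟩ := exists_pointwise_bound
  obtain ⟨c, D, hc0, hD0, hcD⟩ := b.exists_dist_bounds hpj hk
  have hk0 : (0 : ℝ) < k := by positivity
  set q := b p with hq
  set ε : ℝ := 1 / (4 * k) with hε
  have hε0 : 0 < ε := by positivity
  set z := lagrangeNode k b α with hz
  set P₁ := openParallelogram (ε⁻¹ • b.coordDir p) (ε⁻¹ • b.coordDir l) z with hP₁
  have hP₁c : ∀ x ∈ P₁, (∀ i, 0 ≤ b.coord i x) ∧ 1 / (2 * k : ℝ) ≤ b.coord j x := fun x hx =>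
    b.coord_of_mem_openParallelogram hpj hlj hlp hk hα hαj hx
  have hP₁h : P₁ ⊆ convexHull ℝ (range b) := fun x hx => by
    rw [b.convexHull_eq_nonneg_coord]; exact (hP₁c x hx).1
  obtain ⟨V, hV0, hV, -⟩ := (b.isDualFrame hpj hlj hlp hε0.ne').exists_jacobian
  set B : ℝ := ε * (‖b p - b j‖ + ‖b l - b j‖) with hB
  have hB0 : 0 ≤ B := by positivity
  -- the weight of order `n` is bounded below on the unscaled parallelogram
  have hμ : ∀ n : ℕ, ∃ μ : ℝ, 0 < μ ∧ ∀ x ∈ P₁, μ ≤ dist x q ^ ((n : ℝ) - (a + 1)) := by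
    intro n
    refine ⟨min (c ^ ((n : ℝ) - (a + 1))) (D ^ ((n : ℝ) - (a + 1))),
      lt_min (Real.rpow_pos_of_pos hc0 _) (Real.rpow_pos_of_pos hD0 _), fun x hx => ?_⟩
    obtain ⟨h1, h2⟩ := hcD x (hP₁h hx)
    have h2 := h2 (hP₁c x hx).2
    rcases le_total 0 ((n : ℝ) - (a + 1)) with h | h
    · exact (min_le_left _ _).trans (Real.rpow_le_rpow hc0.le h2 h)
    · exact (min_le_right _ _).trans (Real.rpow_le_rpow_of_nonpos (hc0.trans_le h2) h1 h)
  choose μ hμ0 hμ using hμ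
  set W₀ : ℝ := ∑ n ∈ Finset.range 3, ∑ _ν ∈ Finset.HasAntidiagonal.antidiagonal n,
    B ^ n * (μ n)⁻¹ with hW
  have hW0 : 0 ≤ W₀ := Finset.sum_nonneg fun n _ => Finset.sum_nonneg fun ν _ =>
    mul_nonneg (pow_nonneg hB0 n) (inv_nonneg.2 (hμ0 n).le)
  refine ⟨K * W₀ * √V / V, by positivity, ?_⟩
  intro r hr R hR v u g hg hu huv
  set T := scaledTriangle q r b with hT
  rw [lagrangeNode_scaledTriangle q r b hk hα, ← hz]
  set P := openParallelogram ((ε * r)⁻¹ • b.coordDir p) ((ε * r)⁻¹ • b.coordDir l)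
    (AffineMap.homothety q r z) with hP
  have hPim : P = AffineMap.homothety q r '' P₁ := openParallelogram_scaled _ _ _ _ hr
  have hPT : P ⊆ T.closed := by
    rw [hPim, closed_scaledTriangle]; exact image_mono hP₁h
  have hPo : IsOpen P := isOpen_openParallelogram _ _ _
  have hPG : P ⊆ T.opened := interior_maximal hPT hPo
  have hPvol : volume P = ENNReal.ofReal (r ^ 2 * V) := by
    rw [hPim, Plane.volume_image_homothety hr, hV, ENNReal.ofReal_mul (by positivity)]
  have hPreal : volume.real P = r ^ 2 * V := by
    rw [measureReal_def, hPvol, ENNReal.toReal_ofReal (by positivity)]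
  have hzT : AffineMap.homothety q r z ∈ T.closed := by
    rw [closed_scaledTriangle]
    refine ⟨z, ?_, rfl⟩
    change z ∈ convexHull ℝ (range b)
    rw [b.convexHull_eq_nonneg_coord, mem_ofPred_eq]
    intro i
    rw [hz, b.coord_lagrangeNode hk hα]
    positivity
  have hβ : ∀ w : Plane, ‖w‖ ≤ ‖b p - b j‖ + ‖b l - b j‖ → ∀ i, |((ε * r) • w) i| ≤ r * B := by
    intro w hw i
    refine (PiLp.norm_apply_le ((ε * r) • w) i).trans ?_
    rw [norm_smul, Real.norm_of_nonneg (by positivity), hB, ← mul_assoc, mul_comm ε r]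
    gcongr
  -- On the scaled parallelogram the weight is at least $r^{|\nu|-a-1}$ times its lower bound on the
  -- unscaled one.
  have hint : ∀ ν : ℕ × ℕ, ν.1 + ν.2 ≤ 2 → IntegrableOn (g ν) P ∧ ∫ x in P, |g ν x| ≤
      (r ^ (((ν.1 + ν.2 : ℕ) : ℝ) - (a + 1)) * μ (ν.1 + ν.2))⁻¹ * √(volume.real P) * R := by
    intro ν hν
    have hrp : 0 < r ^ (((ν.1 + ν.2 : ℕ) : ℝ) - (a + 1)) := Real.rpow_pos_of_pos hr _
    have hμp := hμ0 (ν.1 + ν.2)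
    refine integral_abs_le_of_weighted hPo.measurableSet hPG (by rw [hPvol]; exact
      ENNReal.ofReal_ne_top) (by positivity) hR (hg ν hν).1.2.1 ?_ (hg ν hν).2
    intro x hx
    rw [hPim] at hx
    obtain ⟨y, hy, rfl⟩ := hx
    rw [Plane.dist_homothety hr, Real.mul_rpow hr.le dist_nonneg,
      abs_of_nonneg (mul_nonneg hrp.le (Real.rpow_nonneg dist_nonneg _)), ← div_eq_inv_mul,
      one_le_div (by positivity)]
    exact mul_le_mul_of_nonneg_left (hμ _ y hy) hrp.le
  have main := hK _ _ _ _ (b.isDualFrame hpj hlj hlp (mul_pos hε0 hr).ne') (r * B)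
    (hβ _ (le_add_of_nonneg_right (norm_nonneg _)))
    (hβ _ (le_add_of_nonneg_left (norm_nonneg _))) (AffineMap.homothety q r z) T.opened v u g hPG
    (fun ν hν => (hg ν hν).1) (fun ν hν => (hint ν hν).1) ((hu _ hzT).mono hPT)
    (ae_restrict_of_ae_restrict_of_subset hPG huv)
  rw [← hP] at main
  have hsqrt : √(volume.real P) = r * √V := by
    rw [hPreal, Real.sqrt_mul (by positivity), Real.sqrt_sq hr.le]
  have hsum : ∑ n ∈ Finset.range 3, ∑ ν ∈ Finset.HasAntidiagonal.antidiagonal n,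
      (r * B) ^ n * ∫ x in P, |g ν x| ≤ W₀ * (r ^ (a + 2) * √V * R) := by
    rw [hW, Finset.sum_mul]
    refine Finset.sum_le_sum fun n hn => ?_
    rw [Finset.sum_mul]
    refine Finset.sum_le_sum fun ν hν => ?_
    have hνn : ν.1 + ν.2 = n := Finset.HasAntidiagonal.mem_antidiagonal.1 hν
    have hn2 : n ≤ 2 := by have := Finset.mem_range.1 hn; omega
    have h1 := (hint ν (hνn.le.trans hn2)).2
    rw [hνn, hsqrt] at h1
    refine (mul_le_mul_of_nonneg_left h1 (by positivity)).trans (le_of_eq ?_)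
    -- The powers of `r` come from the frame, the inverse weight and the square root of the area.
    -- Their product does not depend on the order `n`; division by the area then leaves `r ^ a`.
    have h2 : r ^ (a + 2) = r ^ n * (r ^ ((n : ℝ) - (a + 1)))⁻¹ * r := by
      rw [← Real.rpow_neg hr.le, ← Real.rpow_natCast, ← Real.rpow_add hr, ← Real.rpow_add_one hr.ne']
      congr 1; ring
    rw [h2, mul_pow, mul_inv]
    ring
  rw [hPreal] at main
  have h3 : |u (AffineMap.homothety q r z)| * (r ^ 2 * V) ≤
      K * (W₀ * (r ^ (a + 2) * √V * R)) := main.trans (mul_le_mul_of_nonneg_left hsum hK0.le)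
  have h4 : r ^ (a + 2) = r ^ a * r ^ 2 := by
    rw [← Real.rpow_natCast r 2, ← Real.rpow_add hr]; norm_num
  refine le_of_mul_le_mul_right (h3.trans (le_of_eq ?_)) (by positivity : 0 < r ^ 2 * V)
  rw [h4]
  field_simp

/-- The interpolation error on a scaled triangle in the seminorm of `H¹`. -/
theorem AffineBasis.exists_interpolation_error_le (b : AffineBasis (Fin 3) ℝ Plane) (p : Fin 3)
    {k m : ℕ} (hk : 1 ≤ k) (hm : 1 ≤ m) {a : ℝ} (ha : 0 < a) :
    ∃ C : ℝ, 0 < C ∧ ∀ r : ℝ, 0 < r → ∀ (v u vI : Plane → ℝ) (s : MvPolynomial (Fin 2) ℝ),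
      ContinuousOn u (scaledTriangle (b p) r b).closed →
      u =ᵐ[volume.restrict (scaledTriangle (b p) r b).opened] v →
      s.totalDegree ≤ k → EqOn vI (polyFun s) (scaledTriangle (b p) r b).closed →
      (∀ x ∈ lagrangeNodes k (scaledTriangle (b p) r b), vI x = u x) →
      h1Seminorm (scaledTriangle (b p) r b).opened (fun x => v x - vI x) ≤
        ENNReal.ofReal (C * r ^ a) *
          kondratievNorm (fun _ : Unit => b p) (fun _ => a + 1) (m + 1)
            (scaledTriangle (b p) r b).opened v := by
  set q := b p with hq
  obtain ⟨C₁, hC₁0, hC₁⟩ := b.exists_partialDeriv_le hk q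
  -- a bound for all nodal values
  have hnode : ∀ α : Fin 3 → ℕ, ∃ C : ℝ, 0 ≤ C ∧ (∑ j, α j = k → ∀ r : ℝ, 0 < r →
      ∀ R : ℝ, 0 ≤ R → ∀ (v u : Plane → ℝ) (g : ℕ × ℕ → Plane → ℝ),
      HasWeightedJet (scaledTriangle q r b).opened q a R v g →
      ContinuousOn u (scaledTriangle q r b).closed →
      u =ᵐ[volume.restrict (scaledTriangle q r b).opened] v →
      |u (lagrangeNode k (scaledTriangle q r b) α)| ≤ C * r ^ a * R) := by
    intro α
    by_cases hα : ∑ j, α j = k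
    -- Either the node has positive weight at a vertex other than `q`, or it is `q` itself, where
    -- the value is zero.
    · by_cases hex : ∃ j, p ≠ j ∧ 1 ≤ α j
      · obtain ⟨j, hpj, hαj⟩ := hex
        obtain ⟨C, hC0, hC⟩ := b.exists_node_bound hpj hk hα hαj a
        exact ⟨C, hC0, fun _ => hC⟩
      · push Not at hex
        refine ⟨0, le_rfl, fun _ r hr R hR v u g hg hu huv => ?_⟩
        have hα0 : ∀ j, j ≠ p → α j = 0 := fun j hj => by have := hex j hj.symm; omega
        have hαp : α p = k := by rw [← hα, Finset.sum_eq_single p (fun j _ hj => hα0 j hj) (by simp)]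
        have hz : lagrangeNode k (scaledTriangle q r b) α = q := by
          rw [lagrangeNode, Finset.sum_eq_single p (fun j _ hj => by simp [hα0 j hj]) (by simp),
            hαp, div_self (by positivity), one_smul, scaledTriangle, ← hq,
            AffineMap.homothety_apply_same]
        rw [hz, eq_zero_of_weighted ha hr hg hu huv]
        simp
    · exact ⟨0, le_rfl, fun h => absurd h hα⟩
  choose C₂ hC₂0 hC₂ using hnode
  set C₃ : ℝ := ∑ α ∈ nodeIndices k, C₂ α with hC₃
  have hC₃0 : 0 ≤ C₃ := Finset.sum_nonneg fun α _ => hC₂0 α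
  have hbdd : Bornology.IsBounded (PlaneTriangle.closed b) :=
    ((finite_range b).isCompact_convexHull (𝕜 := ℝ)).isBounded
  obtain ⟨D, hD0, hD⟩ := hbdd.subset_closedBall_lt 0 q
  set V := volume.real (PlaneTriangle.closed b) with hV
  have hVt : volume (PlaneTriangle.closed b) ≠ ⊤ := hbdd.measure_lt_top.ne
  have hV0 : 0 ≤ V := ENNReal.toReal_nonneg
  -- Each 4 is a 2 from $(x-y)^2\le 2x^2+2y^2$ times the two first-order derivatives. The summand 1
  -- gives `C ≤ C ^ 2`, which lets `C` itself be the constant after the square root is taken.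
  set C : ℝ := 1 + 4 * (D ^ a) ^ 2 + 4 * (C₁ * C₃) ^ 2 * V with hC
  have hC1 : 1 ≤ C := by
    have : 0 ≤ 4 * (D ^ a) ^ 2 + 4 * (C₁ * C₃) ^ 2 * V := by positivity
    linarith
  refine ⟨C, by linarith, ?_⟩
  intro r hr v u vI s hu huv hs hvI hnodes
  set T := scaledTriangle q r b with hT
  have hra : 0 < r ^ a := Real.rpow_pos_of_pos hr a
  by_cases hfin : kondratievNorm (fun _ : Unit => q) (fun _ => a + 1) (m + 1) T.opened v = ⊤
  · rw [hfin, ENNReal.mul_top (ENNReal.ofReal_pos.2 (by positivity)).ne']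
    exact le_top
  obtain ⟨g, hg⟩ := exists_hasWeightedJet (isOpen_opened T) hm hfin
  set R := (kondratievNorm (fun _ : Unit => q) (fun _ => a + 1) (m + 1) T.opened v).toReal with hR
  have hR0 : 0 ≤ R := ENNReal.toReal_nonneg
  rw [← ENNReal.ofReal_toReal hfin, ← hR, ← ENNReal.ofReal_mul (by positivity)]
  have hTo := isOpen_opened T
  -- the gradient of the interpolant
  set E : ℝ := C₁ * (C₃ * r ^ a * R) / r with hE
  have hE0 : 0 ≤ E := by positivity
  have hgrad : ∀ x ∈ T.opened, ∀ j, |partialDeriv j (polyFun s) x| ≤ E := by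
    intro x hx j
    have hx' := opened_subset_closed T hx
    rw [hT, closed_scaledTriangle] at hx'
    obtain ⟨y, hy, rfl⟩ := hx'
    refine hC₁ r hr s hs _ (fun α hα => ?_) y hy j
    rw [← lagrangeNode_scaledTriangle q r b hk hα]
    have hmem : lagrangeNode k T α ∈ T.closed := by
      refine (convex_convexHull ℝ (range T)).sum_mem (fun _ _ => by positivity) ?_
        fun i _ => subset_convexHull ℝ _ (mem_range_self i)
      rw [← Finset.sum_div, ← Nat.cast_sum, hα, div_self (by positivity)]
    have hval : vI (lagrangeNode k T α) = u (lagrangeNode k T α) := hnodes _ ⟨α, hα, rfl⟩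
    rw [← hvI hmem, hval]
    refine (hC₂ α hα r hr R hR0 v u g hg hu huv).trans ?_
    gcongr
    exact Finset.single_le_sum (fun α _ => hC₂0 α) (mem_nodeIndices.2 hα)
  have hvol : volume T.opened ≤ ENNReal.ofReal (r ^ 2 * V) := by
    refine (measure_mono (opened_subset_closed T)).trans (le_of_eq ?_)
    rw [hT, closed_scaledTriangle, Plane.volume_image_homothety hr,
      ENNReal.ofReal_mul (by positivity), hV, measureReal_def, ENNReal.ofReal_toReal hVt]
  set M : ℝ := (r * D) ^ a with hM
  have hM0 : 0 ≤ M := by positivity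
  -- Away from `q` the weight can be inserted and removed: `dist x q ^ a * dist x q ^ (-a) = 1`.
  have hne : ∀ᵐ x ∂(volume.restrict T.opened), x ≠ q :=
    ae_restrict_of_ae (compl_mem_ae_iff.2 (measure_singleton q))
  have hterm : ∀ ν ∈ Finset.HasAntidiagonal.antidiagonal 1,
      ⨅ (h : Plane → ℝ) (_ : HasWeakDeriv T.opened ν (fun x => v x - vI x) h),
        ∫⁻ x in T.opened, ‖(1 : ℝ) * h x‖ₑ ^ 2 ≤
      ENNReal.ofReal (2 * M ^ 2 * R ^ 2 + 2 * E ^ 2 * (r ^ 2 * V)) := by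
    intro ν hν
    have hν1 : ν.1 + ν.2 = 1 := Finset.HasAntidiagonal.mem_antidiagonal.1 hν
    obtain ⟨hw, hI⟩ := hg ν (by omega)
    have hIw : HasWeakDeriv T.opened ν vI (multiDeriv ν (polyFun s)) :=
      ((contDiff_polyFun s).hasWeakDeriv hν).congr hTo.measurableSet
        fun x hx => (hvI (opened_subset_closed T hx)).symm
    have hgradν : ∀ x ∈ T.opened, |multiDeriv ν (polyFun s) x| ≤ E := by
      intro x hx
      have : ν = (1, 0) ∨ ν = (0, 1) := by
        rcases ν with ⟨c, d⟩
        simp only [Prod.mk.injEq] at hν1 ⊢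
        omega
      rcases this with rfl | rfl
      · exact hgrad x hx 0
      · exact hgrad x hx 1
    refine (iInf₂_le _ (hw.sub hIw)).trans ?_
    rw [hν1, Nat.cast_one, show (1 : ℝ) - (a + 1) = -a by ring] at hI
    calc ∫⁻ x in T.opened, ‖(1 : ℝ) * (g ν x - multiDeriv ν (polyFun s) x)‖ₑ ^ 2
        ≤ ∫⁻ x in T.opened, (ENNReal.ofReal (2 * M ^ 2) * ‖dist x q ^ (-a) * g ν x‖ₑ ^ 2 +
            ENNReal.ofReal (2 * E ^ 2)) := by
          refine lintegral_mono_ae ?_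
          filter_upwards [hne, ae_restrict_mem hTo.measurableSet] with x hxq hx
          have hsq : ∀ y : ℝ, ‖y‖ₑ ^ 2 = ENNReal.ofReal (y ^ 2) := fun y => by
            rw [Real.enorm_eq_ofReal_abs, ← ENNReal.ofReal_pow (abs_nonneg _), sq_abs]
          rw [hsq, hsq, ← ENNReal.ofReal_mul (by positivity),
            ← ENNReal.ofReal_add (by positivity) (by positivity)]
          refine ENNReal.ofReal_le_ofReal ?_
          have hd0 : 0 < dist x q := dist_pos.2 hxq
          have hdD : dist x q ≤ r * D := by
            have hx' := opened_subset_closed T hx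
            rw [hT, closed_scaledTriangle] at hx'
            obtain ⟨y, hy, rfl⟩ := hx'
            rw [Plane.dist_homothety hr]
            exact mul_le_mul_of_nonneg_left (hD hy) hr.le
          have h1 : dist x q ^ a ≤ M := Real.rpow_le_rpow hd0.le hdD ha.le
          have h2 : g ν x = dist x q ^ a * (dist x q ^ (-a) * g ν x) := by
            rw [← mul_assoc, ← Real.rpow_add hd0, add_neg_cancel, Real.rpow_zero, one_mul]
          set y := dist x q ^ (-a) * g ν x with hy
          have h3 : (g ν x) ^ 2 ≤ M ^ 2 * y ^ 2 := by
            rw [h2, mul_pow]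
            gcongr
          have h4 : (multiDeriv ν (polyFun s) x) ^ 2 ≤ E ^ 2 := by
            rw [← sq_abs]
            exact pow_le_pow_left₀ (abs_nonneg _) (hgradν x hx) 2
          rw [one_mul]
          nlinarith [sq_nonneg (g ν x + multiDeriv ν (polyFun s) x)]
      _ = ENNReal.ofReal (2 * M ^ 2) * (∫⁻ x in T.opened, ‖dist x q ^ (-a) * g ν x‖ₑ ^ 2) +
            ENNReal.ofReal (2 * E ^ 2) * volume T.opened := by
          rw [lintegral_add_right _ measurable_const, lintegral_const_mul' _ _ ENNReal.ofReal_ne_top,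
            setLIntegral_const]
      _ ≤ ENNReal.ofReal (2 * M ^ 2) * ENNReal.ofReal (R ^ 2) +
            ENNReal.ofReal (2 * E ^ 2) * ENNReal.ofReal (r ^ 2 * V) := by gcongr
      _ = _ := by
          rw [← ENNReal.ofReal_mul (by positivity), ← ENNReal.ofReal_mul (by positivity),
            ← ENNReal.ofReal_add (by positivity) (by positivity)]
  have hsum : weightedSqSum T.opened (fun _ => 1) 1 (fun x => v x - vI x) ≤
      ENNReal.ofReal ((C * r ^ a * R) ^ 2) := by
    refine (Finset.sum_le_card_nsmul _ _ _ hterm).trans ?_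
    rw [Finset.Nat.card_antidiagonal, nsmul_eq_mul, ← ENNReal.ofReal_natCast,
      ← ENNReal.ofReal_mul (by positivity)]
    refine ENNReal.ofReal_le_ofReal ?_
    have h1 : ((1 + 1 : ℕ) : ℝ) * (2 * M ^ 2 * R ^ 2 + 2 * E ^ 2 * (r ^ 2 * V)) =
        (4 * (D ^ a) ^ 2 + 4 * (C₁ * C₃) ^ 2 * V) * (r ^ a * R) ^ 2 := by
      rw [hM, hE, Real.mul_rpow hr.le hD0.le]
      push_cast
      field_simp
      ring
    rw [h1, mul_assoc C, mul_pow C]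
    have h2 : 4 * (D ^ a) ^ 2 + 4 * (C₁ * C₃) ^ 2 * V ≤ C ^ 2 := by nlinarith
    gcongr
  refine (ENNReal.rpow_le_rpow hsum (by norm_num)).trans (le_of_eq ?_)
  rw [ENNReal.ofReal_rpow_of_nonneg (by positivity) (by norm_num), ← Real.sqrt_eq_rpow,
    Real.sqrt_sq (by positivity)]

/-! ### The estimate on the innermost layer -/

theorem mainTheorem4 {N : ℕ} (Ω : Set Plane) (Q : Fin N → Plane)
    (hΩ : IsPolygonalDomain Ω Q)
    (k m : ℕ) (hk : 1 ≤ k) (hm : 1 ≤ m)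
    (a : Fin N → ℝ) (θ : ℝ) (ha : ∀ j, 0 < a j) (haθ : ∀ j, a j ≤ θ)
    (hθ : θ ≤ min (k : ℝ) (m : ℝ))
    (κ : Fin N → ℝ) (hκ : ∀ j, κ j = (2 : ℝ) ^ (-(θ / a j)))
    (𝒯₀ : Set PlaneTriangle) (h𝒯 : IsTriangulation Ω 𝒯₀)
    (hone : ∀ T ∈ 𝒯₀, ∀ i j, Q i ∈ PlaneTriangle.closed T → Q j ∈ PlaneTriangle.closed T → i = j)
    (T₀ : PlaneTriangle) (hT₀ : T₀ ∈ 𝒯₀) (i : Fin N) (hi : Q i ∈ range T₀) :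
    ∃ C : ℝ, 0 < C ∧ ∃ n₀ : ℕ, ∀ n : ℕ, n₀ ≤ n →
      ∀ T : PlaneTriangle, IsAttachedTriangle Q κ 𝒯₀ T₀ (Q i) n T →
      ∀ v : Plane → ℝ, MemKondratiev Q (fun j => a j + 1) (m + 1) Ω v →
      ∀ vI : Plane → ℝ, IsNodalInterpolant Ω (gradedMesh Q κ 𝒯₀ n) k v vI →
        h1Seminorm T.opened (fun x => v x - vI x) ≤
          ENNReal.ofReal (C * ((1 / 2 : ℝ) ^ n) ^ θ) *
            kondratievNorm (fun _ : Unit => Q i) (fun _ => a i + 1) (m + 1) T.opened v := by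
  have hκ01 : ∀ j, κ j ∈ Ioo (0 : ℝ) 1 := fun j => by
    rw [hκ]
    exact ⟨Real.rpow_pos_of_pos two_pos _, Real.rpow_lt_one_of_one_lt_of_neg one_lt_two
      (neg_lt_zero.2 (div_pos ((ha j).trans_le (haθ j)) (ha j)))⟩
  -- The constant depends on the ancestor but not on the level, since the estimate is uniform in the
  -- ratio `r`. Triangles that cannot be ancestors get the dummy constant 1.
  have hex : ∀ T' : PlaneTriangle, ∃ C : ℝ, 0 < C ∧ (T' ∈ 𝒯₀ → ∀ p, T' p = Q i →
      ∀ r : ℝ, 0 < r → ∀ (v u vI : Plane → ℝ) (s : MvPolynomial (Fin 2) ℝ),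
      ContinuousOn u (scaledTriangle (Q i) r T').closed →
      u =ᵐ[volume.restrict (scaledTriangle (Q i) r T').opened] v →
      s.totalDegree ≤ k → EqOn vI (polyFun s) (scaledTriangle (Q i) r T').closed →
      (∀ x ∈ lagrangeNodes k (scaledTriangle (Q i) r T'), vI x = u x) →
      h1Seminorm (scaledTriangle (Q i) r T').opened (fun x => v x - vI x) ≤
        ENNReal.ofReal (C * r ^ a i) *
          kondratievNorm (fun _ : Unit => Q i) (fun _ => a i + 1) (m + 1)
            (scaledTriangle (Q i) r T').opened v) := by
    intro T'
    by_cases h : T' ∈ 𝒯₀ ∧ ∃ p, T' p = Q i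
    · obtain ⟨hT', p, hp⟩ := h
      obtain ⟨b, rfl⟩ := (h𝒯.nondegenerate T' hT').exists_affineBasis
      obtain ⟨C, hC0, hC⟩ := b.exists_interpolation_error_le p hk hm (ha i)
      rw [hp] at hC
      exact ⟨C, hC0, fun _ _ _ => hC⟩
    · exact ⟨1, one_pos, fun hT' p hp => absurd ⟨hT', p, hp⟩ h⟩
  choose C hC0 hC using hex
  -- The ancestor is not identified with `T₀`, as triangles are ordered triples of vertices and are
  -- matched here only through containment; the sum over the finite initial mesh dominates every
  -- possible constant. The scaling argument holds at every level, so the threshold is 0.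
  refine ⟨∑ T' ∈ h𝒯.finite.toFinset, C T',
    Finset.sum_pos (fun T' _ => hC0 T') ⟨T₀, h𝒯.finite.mem_toFinset.2 hT₀⟩, 0, ?_⟩
  intro n _ T hT v _ vI hvI
  obtain ⟨T', hT', hsub, p, hp, hTe⟩ := hT.exists_eq_homothety hΩ.injective hκ01 h𝒯 hT₀ hi
  have hTs : T = scaledTriangle (Q i) (κ i ^ n) T' := hTe
  obtain ⟨⟨-, hpoly⟩, u, hu, huv, hnodes⟩ := hvI
  obtain ⟨s, hs, hsT⟩ := hpoly T hT.1
  have hTΩ : T.closed ⊆ closure Ω := by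
    rw [← h𝒯.cover]
    exact hsub.trans (subset_biUnion_of_mem (u := fun T => PlaneTriangle.closed T) hT')
  -- The triangles cover only the closure of `Ω`; the absence of cracks puts their interiors in `Ω`,
  -- where `u = v` almost everywhere.
  have hToΩ : T.opened ⊆ Ω := by
    rw [← hΩ.regular]
    exact interior_mono hTΩ
  -- The grading is chosen for this: $\kappa^{a_i}=2^{-\theta}$.
  have hpow : (κ i ^ n) ^ a i = ((1 / 2 : ℝ) ^ n) ^ θ := by
    have hi0 : a i ≠ 0 := (ha i).ne'
    rw [hκ, one_div, inv_pow, ← Real.rpow_natCast, ← Real.rpow_natCast, ← Real.rpow_mul two_pos.le,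
      ← Real.rpow_mul two_pos.le, ← Real.rpow_neg two_pos.le, ← Real.rpow_mul two_pos.le]
    congr 1
    field_simp
  have main := hC T' hT' p hp (κ i ^ n) (pow_pos (hκ01 i).1 n) v u vI s
  rw [← hTs] at main
  refine (main (hu.mono hTΩ) (ae_restrict_of_ae_restrict_of_subset hToΩ huv) hs hsT
    (hnodes T hT.1)).trans ?_
  rw [hpow]
  gcongr
  exact Finset.single_le_sum (fun T' _ => (hC0 T').le) (h𝒯.finite.mem_toFinset.2 hT')
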